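/- The language of $\mathrm{PV}$ has the relation symbol $\le$ and a function symbol for every polynomial-time function, generated as in Cobham's theorem: starting from $0$, $S$, $+$, $\cdot$, $x\#y=2^{|x||y|}$, $\lfloor x/2\rfloor$, the binary length $|x|$, the characteristic function of $\le$ and the projections, it is closed under composition and under limited recursion on notation $f(0,\vec y)=g(\vec y)$, $f(x,\vec y)=\min\bigl(h(x,f(\lfloor x/2\rfloor,\vec y),\vec y),\,k(x,\vec y)\bigr)$ for $x\ne 0$. The first-order theory $\mathrm{PV}_1$ in this language consists of Buss's 32 axioms $\mathrm{BASIC}$, the defining equations of the function symbols, and polynomial induction $\varphi(0)\wedge\forall x\,(\varphi(\lfloor x/2\rfloor)\to\varphi(x))\to\forall x\,\varphi(x)$ for all open formulas $\varphi$ (with parameters). Say that $\mathrm{PV}_1$ proves a sentence if the sentence is true in every model of $\mathrm{PV}_1$ (equivalently, by the completeness theorem, if it has a formal proof from $\mathrm{PV}_1$). Let $\mathrm{Prime}(p)$ be the formula $p>1\wedge(\forall y\le p)(y\mid p\to y=1\vee y=p)$, where $y\mid p$ means $(\exists z\le p)(y\cdot z=p)$, and let $x=1^{(n)}$ mean that $|x|=n$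 and all binary digits of $x$ are ones, i.e. $|x|=n$ and $x+1=2^{|x|}$ (written $S(x)=1\#x$). **Theorem (Legendre's formula in $\mathrm{PV}_1$).** Let $\lfloor x/m\rfloor$, $p^{|y|}$, $\nu_p(x)$, $\mathrm{Fact}(x)$ and $\sigma(y,m,p)=\sum_{i=1}^{|y|}\lfloor m/p^i\rfloor$ be the $\mathrm{PV}$-symbols given by the obvious algorithms (binary long division; iterated multiplication; counting how often $x$ can be divided by $p$; iterated multiplication by lengths; iterated addition). Then $\mathrm{PV}_1$ proves (universally quantified) 1. $m\ne0\to m\lfloor x/m\rfloor\le x<m(\lfloor x/m\rfloor+1)$; 2. $p^{|0|}=1$, and $p^{|y|}=p^{|\lfloor y/2\rfloor|}\cdot p$ for $y\neq 0$; 3. $\nu_p(0)=0$, and for $p>1$, $x\ne0$: $\nu_p(x)=\nu_p(\lfloor x/p\rfloor)+1$ if $p\mid x$, and $\nu_p(x)=0$ if $p\nmid x$; 4. $\mathrm{Fact}(0)=1$, and $\mathrm{Fact}(x)=\mathrm{Fact}(\lfloor x/2\rfloor)\cdot|x|$ for $x\ne0$ (so $\mathrm{Fact}(x)=|x|!$ in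 $\mathbb N$); 5. $\sigma(0,m,p)=0$, and $\sigma(y,m,p)=\sigma(\lfloor y/2\rfloor,m,p)+\lfloor m/p^{|y|}\rfloor$ for $y\neq0$; and $\mathrm{PV}_1$ proves Legendre's formula: for all $x,n,p$, $$x=1^{(n)}\wedge\mathrm{Prime}(p)\ \to\ \nu_p(\mathrm{Fact}(x))=\sum_{i=1}^{|n|}\lfloor n/p^i\rfloor,$$ where the sum is $\sigma(n,n,p)$. -/

import Mathlib

open FirstOrder
open FirstOrder.Language (Term BoundedFormula Relations)

namespace BoundedArith

/-! ### The language of PV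

Function symbols for all polynomial-time functions, generated as in Cobham's theorem from the
function symbols of Buss's language, the characteristic function of `≤` and the projections, by
composition and limited recursion on notation. -/

/-- `PVSym n` is the type of the `n`-ary function symbols of PV. -/
inductive PVSym : ℕ → Type
  /-- the constant `0` -/
  | zero : PVSym 0
  /-- the successor `S x` -/
  | succ : PVSym 1
  /-- addition -/
  | add : PVSym 2
  /-- multiplication -/
  | mul : PVSym 2
  /-- the smash function `x # y = 2 ^ (|x| * |y|)` -/
  | smash : PVSym 2
  /-- `⌊x / 2⌋` -/
  | half : PVSym 1
  /-- the binary length `|x|` -/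
  | len : PVSym 1
  /-- the characteristic function of `x ≤ y` -/
  | leq : PVSym 2
  /-- the `i`-th projection -/
  | proj {n : ℕ} (i : Fin n) : PVSym n
  /-- composition `x ↦ f (g 0 x, …, g (m - 1) x)` -/
  | comp {m n : ℕ} (f : PVSym m) (g : Fin m → PVSym n) : PVSym n
  /-- limited recursion on notation: the symbol `f` with `f (0, y) = g y` and, for `x ≠ 0`,
  `f (x, y) = min (h (x, f (⌊x / 2⌋, y), y)) (k (x, y))`. Taking the minimum with the bound `k`
  makes the scheme applicable to all `g`, `h`, `k`; where the bound holds it is the usual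
  recursion. -/
  | limRec {n : ℕ} (g : PVSym n) (h : PVSym (n + 2)) (k : PVSym (n + 1)) : PVSym (n + 1)

/-- The only relation symbol besides equality is `≤`. -/
inductive PVRel : ℕ → Type
  | le : PVRel 2

/-- The first-order language of PV. -/
def PV : FirstOrder.Language.{0, 0} := ⟨PVSym, PVRel⟩

section Terms

variable {α : Type}

/-- Application of a PV symbol to terms. -/
def app {n : ℕ} (f : PVSym n) (ts : Fin n → PV.Term α) : PV.Term α :=
  Term.func (L := PV) f ts

instance : Zero (PV.Term α) := ⟨app .zero ![]⟩

/-- The successor `S t`. -/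
def S (t : PV.Term α) : PV.Term α := app .succ ![t]

instance : One (PV.Term α) := ⟨S 0⟩
instance : Add (PV.Term α) := ⟨fun t u => app .add ![t, u]⟩
instance : Mul (PV.Term α) := ⟨fun t u => app .mul ![t, u]⟩

/-- The smash function `t # u`. -/
def smash (t u : PV.Term α) : PV.Term α := app .smash ![t, u]

/-- `⌊t / 2⌋`. -/
def half (t : PV.Term α) : PV.Term α := app .half ![t]

/-- The length `|t|`. -/
def len (t : PV.Term α) : PV.Term α := app .len ![t]

/-- The term `2 · t`, that is `S (S 0) · t`. -/
def dbl (t : PV.Term α) : PV.Term α := S 1 * t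

end Terms

section Formulas

variable {n : ℕ}

/-- Terms in the variables `&0, …, &(n - 1)`. -/
abbrev Tm (n : ℕ) : Type := PV.Term (Empty ⊕ Fin n)

/-- Formulas whose free variables are among `&0, …, &(n - 1)`. -/
abbrev Fm (n : ℕ) : Type := PV.BoundedFormula Empty n

/-- The list of variables `&0, …, &(n - 1)`. -/
def vars (n : ℕ) : Fin n → Tm n := fun i => &i

/-- The formula `t ≤ u`. -/
def le (t u : Tm n) : Fm n := Relations.boundedFormula₂ (L := PV) PVRel.le t u

/-- The formula `t < u`, that is `t ≤ u ∧ t ≠ u`. -/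
def lt (t u : Tm n) : Fm n := le t u ⊓ ∼(t =' u)

/-- The formula `t ≠ u`. -/
def ne (t u : Tm n) : Fm n := ∼(t =' u)

end Formulas

/-! ### The axioms -/

/-- Buss's 32 axioms BASIC, as open formulas in at most four variables. -/
def basicFormulas : Set (Fm 4) :=
  let x : Tm 4 := &0
  let y : Tm 4 := &1
  let z : Tm 4 := &2
  let u : Tm 4 := &2
  let v : Tm 4 := &3
  { le y x ⟹ le y (S x),
    ne x (S x),
    le 0 x,
    (le x y ⊓ ne x y) ⇔ le (S x) y,
    ne x 0 ⟹ ne (dbl x) 0,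
    le y x ⊔ le x y,
    (le x y ⊓ le y x) ⟹ x =' y,
    (le x y ⊓ le y z) ⟹ le x z,
    len 0 =' (0 : Tm 4),
    ne x 0 ⟹ (len (dbl x) =' S (len x) ⊓ len (S (dbl x)) =' S (len x)),
    len 1 =' (1 : Tm 4),
    le x y ⟹ le (len x) (len y),
    len (smash x y) =' S (len x * len y),
    smash 0 y =' (1 : Tm 4),
    ne x 0 ⟹ (smash 1 (dbl x) =' dbl (smash 1 x) ⊓ smash 1 (S (dbl x)) =' dbl (smash 1 x)),
    smash x y =' smash y x,
    len x =' len y ⟹ smash x z =' smash y z,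
    len x =' (len u + len v) ⟹ smash x y =' (smash u y * smash v y),
    le x (x + y),
    (le x y ⊓ ne x y) ⟹ (le (S (dbl x)) (dbl y) ⊓ ne (S (dbl x)) (dbl y)),
    (x + y) =' (y + x),
    (x + 0) =' x,
    (x + S y) =' S (x + y),
    ((x + y) + z) =' (x + (y + z)),
    le (x + y) (x + z) ⇔ le y z,
    (x * 0) =' (0 : Tm 4),
    (x * S y) =' (x * y + x),
    (x * y) =' (y * x),
    (x * (y + z)) =' (x * y + x * z),
    le 1 x ⟹ (le (x * y) (x * z) ⇔ le y z),
    ne x 0 ⟹ len x =' S (len (half x)),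
    x =' half y ⇔ (dbl x =' y ⊔ S (dbl x) =' y) }

/-- BASIC: the universal closures of Buss's axioms. -/
def BASIC : PV.Theory := BoundedFormula.alls '' basicFormulas

/-- The recursion equation of `f = limRec g h k`, with recursion variable `x = &0` and parameters
`y = &1, …, &n`: for `x ≠ 0`, the value `f (x, y)` is the minimum of `h (x, f (⌊x / 2⌋, y), y)` and
`k (x, y)`. -/
def limRecStep {n : ℕ} (g : PVSym n) (h : PVSym (n + 2)) (k : PVSym (n + 1)) : Fm (n + 1) :=
  let x : Tm (n + 1) := &0
  let y : Fin n → Tm (n + 1) := fun i => &i.succ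
  let f : Tm (n + 1) → Tm (n + 1) := fun t => app (.limRec g h k) (Fin.cons t y)
  let value : Tm (n + 1) := app h (Fin.cons x (Fin.cons (f (half x)) y))
  let bound : Tm (n + 1) := app k (Fin.cons x y)
  ne x 0 ⟹ ((le value bound ⟹ f x =' value) ⊓ (∼(le value bound) ⟹ f x =' bound))

/-- The defining axioms of the characteristic function of `≤`, of the projections, and of the
symbols introduced by composition and by limited recursion on notation. -/
inductive DefAxiom : PV.Sentence → Prop
  | leq_one : DefAxiom (∀' ∀' (le &0 &1 ⟹ app .leq ![&0, &1] =' (1 : Tm 2)))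
  | leq_zero : DefAxiom (∀' ∀' (∼(le &0 &1) ⟹ app .leq ![&0, &1] =' (0 : Tm 2)))
  | proj {n : ℕ} (i : Fin n) :
      DefAxiom (BoundedFormula.alls (app (.proj i) (vars n) =' (&i : Tm n)))
  | comp {m n : ℕ} (f : PVSym m) (g : Fin m → PVSym n) :
      DefAxiom (BoundedFormula.alls
        (app (.comp f g) (vars n) =' app f (fun i => app (g i) (vars n))))
  | limRec_zero {n : ℕ} (g : PVSym n) (h : PVSym (n + 2)) (k : PVSym (n + 1)) :
      DefAxiom (BoundedFormula.alls
        (app (.limRec g h k) (Fin.cons 0 (vars n)) =' app g (vars n)))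
  | limRec_step {n : ℕ} (g : PVSym n) (h : PVSym (n + 2)) (k : PVSym (n + 1)) :
      DefAxiom (BoundedFormula.alls (limRecStep g h k))

/-- `inst φ t ts` is the formula `φ (t, ts)`: the term `t` is substituted for variable `0` of `φ`
and the terms `ts` for the remaining variables. -/
def inst {n m : ℕ} (φ : PV.Formula (Fin (n + 1))) (t : Tm m) (ts : Fin n → Tm m) : Fm m :=
  BoundedFormula.relabel (n := m) (k := 0) id (BoundedFormula.subst φ (Fin.cons t ts))

/-- The polynomial induction axiom for `φ (x, y)`, where `x` is variable `0` of `φ` and the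
parameters `y` are its other variables:
`∀ y, φ (0, y) ∧ (∀ x, φ (⌊x / 2⌋, y) → φ (x, y)) → ∀ x, φ (x, y)`. -/
def pind {n : ℕ} (φ : PV.Formula (Fin (n + 1))) : PV.Sentence :=
  -- `y i` is the variable `&i`, the variable `x` bound by the inner quantifiers is `&n`
  let x : Tm (n + 1) := &(Fin.last n)
  let y : Fin n → Tm (n + 1) := fun i => &i.castSucc
  BoundedFormula.alls
    ((inst φ 0 (vars n) ⊓ ∀' (inst φ (half x) y ⟹ inst φ x y)) ⟹ ∀' (inst φ x y))

/-- The first-order theory `PV₁`: BASIC, the defining axioms of all PV symbols, and polynomial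
induction for all open (quantifier-free) formulas of the language of PV. -/
def PV₁ : PV.Theory :=
  BASIC ∪ {φ | DefAxiom φ} ∪
    {ψ | ∃ (n : ℕ) (φ : PV.Formula (Fin (n + 1))), φ.IsQF ∧ ψ = pind φ}

/-! ### The PV symbols in the formula of Legendre -/

namespace PVSym

/-- The `n`-ary constant `0`. -/
def const0 (n : ℕ) : PVSym n := comp zero ![]

/-- The `n`-ary constant `1`. -/
def const1 (n : ℕ) : PVSym n := comp succ ![const0 n]

/-- `cond (b, u, v)` is `u` if `b ≠ 0`, and `v` if `b = 0`. -/
def cond : PVSym 3 :=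
  limRec (proj 1) (proj 2) (comp add ![proj 1, proj 2])

/-- `div (x, m) = ⌊x / m⌋` for `m ≠ 0`, by binary long division: with `q = ⌊⌊x / 2⌋ / m⌋`, the
value is `2 q + 1` if `m (2 q + 1) ≤ x`, and `2 q` otherwise. -/
def div : PVSym 2 :=
  limRec (const0 1)
    -- the arguments are `x, q, m`
    (comp cond ![
      comp leq ![comp mul ![proj 2, comp succ ![comp add ![proj 1, proj 1] ] ], proj 0],
      comp succ ![comp add ![proj 1, proj 1] ],
      comp add ![proj 1, proj 1] ])
    (proj 0)

/-- `dvd (m, x)` is `1` if `m` divides `x`, and `0` otherwise; computed as the truth value of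
`x ≤ m ⌊x / m⌋`. -/
def dvd : PVSym 2 :=
  comp leq ![proj 1, comp mul ![proj 0, comp div ![proj 1, proj 0] ] ]

/-- `pow (y, p) = p ^ |y|`, with the bound `p # y`. -/
def pow : PVSym 2 :=
  limRec (const1 1) (comp mul ![proj 1, proj 2]) (comp smash ![proj 1, proj 0])

/-- `strip (y, x, p)`: start with `x`, and `|y|` times divide by `p` if that is possible without
remainder. -/
def strip : PVSym 3 :=
  limRec (proj 0)
    -- the arguments are `y, z, x, p`
    (comp cond ![comp dvd ![proj 3, proj 1], comp div ![proj 1, proj 3], proj 1])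
    (proj 1)

/-- `stripCount (y, x, p)`: the number of divisions without remainder performed by
`strip (y, x, p)`. -/
def stripCount : PVSym 3 :=
  limRec (const0 2)
    -- the arguments are `y, c, x, p`
    (comp add ![proj 1,
      comp dvd ![proj 3, comp strip ![comp half ![proj 0], proj 2, proj 3] ] ])
    (comp len ![proj 0])

/-- The valuation `nu (p, x) = ν_p(x)`: the number of times that `x` can be divided by `p`. -/
def nu : PVSym 2 :=
  comp stripCount ![proj 1, proj 1, proj 0]

/-- The bit-length factorial `fact x = |x|!`, with the bound `x # x`. -/
def fact : PVSym 1 :=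
  limRec (const1 0) (comp mul ![proj 1, comp len ![proj 0] ]) (comp smash ![proj 0, proj 0])

/-- `sumDiv (y, n, p) = ∑_{i = 1}^{|y|} ⌊n / p ^ i⌋`, with the bound `n · |y|`. -/
def sumDiv : PVSym 3 :=
  limRec (const0 2)
    -- the arguments are `y, s, n, p`
    (comp add ![proj 1, comp div ![proj 2, comp pow ![proj 0, proj 3] ] ])
    (comp mul ![proj 1, comp len ![proj 0] ])

end PVSym

section Abbreviations

variable {n : ℕ}

/-- The term `⌊t / u⌋`. -/
def divT (t u : Tm n) : Tm n := app PVSym.div ![t, u]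

/-- The term `p ^ |y|`. -/
def powT (p y : Tm n) : Tm n := app PVSym.pow ![y, p]

/-- The term `ν_p(x)`. -/
def nuT (p x : Tm n) : Tm n := app PVSym.nu ![p, x]

/-- The term `Fact(x)`. -/
def factT (x : Tm n) : Tm n := app PVSym.fact ![x]

/-- The term `∑_{i = 1}^{|y|} ⌊m / p ^ i⌋`. -/
def sumT (y m p : Tm n) : Tm n := app PVSym.sumDiv ![y, m, p]

/-- The term `t` with one more variable `&n` in scope. -/
def up (t : Tm n) : Tm (n + 1) := t.relabel (Sum.map id Fin.castSucc)

/-- The formula `t ∣ u`: there is `z ≤ u` with `t · z = u`. -/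
def dvdF (t u : Tm n) : Fm n :=
  let z : Tm (n + 1) := &(Fin.last n)
  ∃' (le z (up u) ⊓ (up t * z) =' up u)

/-- The formula `Prime(t)`: `t > 1 ∧ (∀ y ≤ t) (y ∣ t → (y = 1 ∨ y = t))`. -/
def primeF (t : Tm n) : Fm n :=
  let y : Tm (n + 1) := &(Fin.last n)
  lt 1 t ⊓ ∀' (le y (up t) ⟹ (dvdF y (up t) ⟹ (y =' 1 ⊔ y =' up t)))

/-- The formula `x = 1^(m)`: `|x| = m` and all binary digits of `x` are ones, that is
`x + 1 = 2 ^ |x|`, which is expressed by `S x = 1 # x`. -/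
def unaryF (x m : Tm n) : Fm n := len x =' m ⊓ S x =' smash 1 x

end Abbreviations

end BoundedArith

open BoundedArith

/-! Provability means truth in all models, so everything is checked in an arbitrary model `M` of
`PV₁`. BASIC together with open polynomial induction makes `M` a discretely ordered commutative
semiring with subtraction and division with remainder. The values of PV symbols may occur in open
formulas, so induction applies to statements about the algorithms themselves. One induction step
leads from `⌊w/2⌋` to `w ≠ 0` and raises `|w|` by exactly one, which is how the factorial of a
length gains one factor.

Fix `x`. For `w ≤ x` the claim is `ν_p(|w|!) = ∑ ⌊|w|/p^i⌋`, where `i` runs up to `||x||`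
independently of `w`. Let `|w| = k + 1`. The left side grows by `ν_p(k + 1)`, by additivity of the
valuation (`nu_mul`). On the right, `⌊k/p^i⌋` grows by one exactly when `p^i ∣ k + 1`
(`quo_add_one`), so the sum grows by the number of such `i ≤ ||x||` (`quoSum_add_one`). This number
is `ν_p(k + 1)`: since `2^i ≤ p^i`, no power with `i ≥ ||x||` divides `k + 1`, so counting further
changes nothing (`cnt_eq_of_le`).

Primality enters through `euclid_lemma`, used in `nu_mul`. There the second factor is at most a
length, so the least `j ≥ 1` with `p ∣ a j` can be found by trying all candidates in polynomial
time. -/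

namespace BoundedArith

open FirstOrder.Language

/-! ### Semantics of PV terms and axioms in a model -/

section Semantics

/-- The value of a PV symbol in a model of `PV₁`. -/
def fn {M : PV₁.ModelType} {n : ℕ} (f : PVSym n) (v : Fin n → M) : M :=
  Structure.funMap (L := PV) f v

variable {M : PV₁.ModelType.{0, 0, 0}}

instance : Zero M := ⟨fn .zero ![]⟩
instance : One M := ⟨fn .succ ![0]⟩
instance : Add M := ⟨fun x y => fn .add ![x, y]⟩
instance : Mul M := ⟨fun x y => fn .mul ![x, y]⟩
instance : LE M := ⟨fun x y => Structure.RelMap (L := PV) PVRel.le ![x, y]⟩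

/-- The successor function of a model. -/
def suc (x : M) : M := fn .succ ![x]

/-- The function `x ↦ ⌊x / 2⌋` of a model. -/
def hf (x : M) : M := fn .half ![x]

/-- The binary length function of a model. -/
def ln (x : M) : M := fn .len ![x]

/-- The smash function of a model. -/
def sm (x y : M) : M := fn .smash ![x, y]

section Realize

variable {α : Type} (v : α → M)

theorem realize_app {n : ℕ} (f : PVSym n) (ts : Fin n → PV.Term α) :
    (app f ts).realize v = fn f (fun i => (ts i).realize v) := rfl

@[simp] theorem realize_app₁ (f : PVSym 1) (t : PV.Term α) :
    (app f ![t]).realize v = fn f ![t.realize v] := by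
  rw [realize_app]; congr 1; funext i; fin_cases i; rfl

@[simp] theorem realize_app₂ (f : PVSym 2) (t u : PV.Term α) :
    (app f ![t, u]).realize v = fn f ![t.realize v, u.realize v] := by
  rw [realize_app]; congr 1; funext i; fin_cases i <;> rfl

@[simp] theorem realize_app₃ (f : PVSym 3) (t u w : PV.Term α) :
    (app f ![t, u, w]).realize v = fn f ![t.realize v, u.realize v, w.realize v] := by
  rw [realize_app]; congr 1; funext i; fin_cases i <;> rfl

@[simp] theorem realize_zero : (0 : PV.Term α).realize v = (0 : M) := by
  change fn _ _ = fn _ _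
  congr 1; exact Subsingleton.elim _ _

@[simp] theorem realize_S (t : PV.Term α) : (S t).realize v = suc (t.realize v) :=
  realize_app₁ v _ _

@[simp] theorem realize_one : (1 : PV.Term α).realize v = (1 : M) := by
  change (S 0).realize v = _
  simp [suc]; rfl

@[simp] theorem realize_add (t u : PV.Term α) :
    (t + u).realize v = t.realize v + u.realize v := realize_app₂ v _ _ _

@[simp] theorem realize_mul (t u : PV.Term α) :
    (t * u).realize v = t.realize v * u.realize v := realize_app₂ v _ _ _

@[simp] theorem realize_half (t : PV.Term α) : (half t).realize v = hf (t.realize v) :=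
  realize_app₁ v _ _

@[simp] theorem realize_len (t : PV.Term α) : (len t).realize v = ln (t.realize v) :=
  realize_app₁ v _ _

@[simp] theorem realize_smash (t u : PV.Term α) :
    (smash t u).realize v = sm (t.realize v) (u.realize v) := realize_app₂ v _ _ _

@[simp] theorem realize_dbl (t : PV.Term α) :
    (dbl t).realize v = suc 1 * t.realize v := by simp [dbl]

end Realize

section RealizeFormula

variable {n : ℕ} (v : Empty → M) (xs : Fin n → M) (t u : Tm n)

@[simp] theorem realize_le :
    (le t u).Realize v xs ↔ t.realize (Sum.elim v xs) ≤ u.realize (Sum.elim v xs) := by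
  exact BoundedFormula.realize_rel₂ (L := PV) (R := PVRel.le)

@[simp] theorem realize_ne :
    (ne t u).Realize v xs ↔ t.realize (Sum.elim v xs) ≠ u.realize (Sum.elim v xs) := by
  simp [ne]

end RealizeFormula

theorem realize_basic {φ : Fm 4} (h : φ ∈ basicFormulas) (xs : Fin 4 → M) :
    φ.Realize default xs := by
  have : M ⊨ φ.alls := Theory.realize_sentence_of_mem PV₁ (Or.inl (Or.inl ⟨φ, h, rfl⟩))
  exact BoundedFormula.realize_alls.1 this xs

theorem realize_def {φ : PV.Sentence} (h : DefAxiom φ) : M ⊨ φ :=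
  Theory.realize_sentence_of_mem PV₁ (Or.inl (Or.inr h))

theorem realize_def_alls {n : ℕ} {φ : Fm n} (h : DefAxiom φ.alls) (xs : Fin n → M) :
    φ.Realize default xs :=
  BoundedFormula.realize_alls.1 (realize_def h) xs

theorem realize_vars {n : ℕ} (v : Empty → M) (xs : Fin n → M) (i : Fin n) :
    (vars n i).realize (Sum.elim v xs) = xs i := rfl

theorem fn_proj {n : ℕ} (i : Fin n) (xs : Fin n → M) : fn (.proj i) xs = xs i :=
  realize_def_alls (.proj i) xs

theorem fn_comp {m n : ℕ} (f : PVSym m) (g : Fin m → PVSym n) (xs : Fin n → M) :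
    fn (.comp f g) xs = fn f (fun i => fn (g i) xs) :=
  realize_def_alls (.comp f g) xs

theorem fn_leq_one {x y : M} (h : x ≤ y) : fn .leq ![x, y] = (1 : M) := by
  have := realize_def (M := M) .leq_one
  simp only [Sentence.Realize, Formula.Realize, BoundedFormula.realize_all,
    BoundedFormula.realize_imp, realize_le, BoundedFormula.realize_bdEqual, realize_app₂,
    realize_one] at this
  exact this x y h

theorem fn_leq_zero {x y : M} (h : ¬ x ≤ y) : fn .leq ![x, y] = (0 : M) := by
  have := realize_def (M := M) .leq_zero
  simp only [Sentence.Realize, Formula.Realize, BoundedFormula.realize_all,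
    BoundedFormula.realize_imp, realize_le, BoundedFormula.realize_bdEqual, realize_app₂,
    realize_zero, BoundedFormula.realize_not] at this
  exact this x y h

theorem fn_limRec_zero {n : ℕ} (g : PVSym n) (h : PVSym (n + 2)) (k : PVSym (n + 1))
    (xs : Fin n → M) : fn (.limRec g h k) (Fin.cons 0 xs) = fn g xs := by
  have := realize_def_alls (M := M) (.limRec_zero g h k) xs
  simp only [BoundedFormula.realize_bdEqual, realize_app, realize_vars] at this
  refine Eq.trans ?_ this
  congr 1; funext i
  refine Fin.cases ?_ (fun i => ?_) i <;> simp [realize_vars]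

theorem fn_limRec_step {n : ℕ} (g : PVSym n) (h : PVSym (n + 2)) (k : PVSym (n + 1))
    {x : M} (hx : x ≠ 0) (xs : Fin n → M) :
    let a := fn h (Fin.cons x (Fin.cons (fn (.limRec g h k) (Fin.cons (hf x) xs)) xs))
    let b := fn k (Fin.cons x xs)
    (a ≤ b → fn (.limRec g h k) (Fin.cons x xs) = a) ∧
      (¬ a ≤ b → fn (.limRec g h k) (Fin.cons x xs) = b) := by
  have := realize_def_alls (M := M) (.limRec_step g h k) (Fin.cons x xs)
  have hcons : ∀ (t : Tm (n + 1)) (m : ℕ) (ts : Fin m → Tm (n + 1)),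
      (fun i => Term.realize (Sum.elim (default : Empty → M) (Fin.cons x xs : Fin (n + 1) → M))
        ((Fin.cons t ts : Fin (m + 1) → Tm (n + 1)) i)) =
      Fin.cons (Term.realize (Sum.elim (default : Empty → M) (Fin.cons x xs : Fin (n + 1) → M)) t)
        fun i => Term.realize (Sum.elim (default : Empty → M)
          (Fin.cons x xs : Fin (n + 1) → M)) (ts i) := by
    intro t m ts; funext i
    refine Fin.cases ?_ (fun i => ?_) i <;> simp
  have h0 : Term.realize (Sum.elim (default : Empty → M) (Fin.cons x xs : Fin (n + 1) → M))
      (&0 : Tm (n + 1)) = x := by simp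
  have hs : (fun i : Fin n => Term.realize (Sum.elim (default : Empty → M)
      (Fin.cons x xs : Fin (n + 1) → M)) (&i.succ : Tm (n + 1))) = xs := by
    funext i; simp
  simp only [limRecStep, BoundedFormula.realize_imp, BoundedFormula.realize_inf,
    BoundedFormula.realize_not, realize_le, realize_ne, BoundedFormula.realize_bdEqual,
    realize_app, hcons, realize_half, realize_zero, h0, hs] at this
  exact this hx

/-! ### Polynomial induction for open properties with parameters -/

/-- The function `f` is given by a term with parameters. -/
class DefFun (f : M → M) : Prop where
  out : ∃ t : PV.Term (Option M), ∀ x, t.realize (fun o => o.elim x id) = f x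

/-- The property `P` is given by an open formula with parameters. -/
class DefPred (P : M → Prop) : Prop where
  out : ∃ φ : PV.Formula (Option M), φ.IsQF ∧ ∀ x, φ.Realize (fun o => o.elim x id) ↔ P x

instance DefFun.const (a : M) : DefFun fun _ => a := ⟨.var (some a), fun _ => rfl⟩

instance DefFun.id : DefFun fun x : M => x := ⟨.var none, fun _ => rfl⟩

theorem DefFun.app {n : ℕ} (s : PVSym n) (f : Fin n → M → M) (h : ∀ i, DefFun (f i)) :
    DefFun fun x => fn s (fun i => f i x) := by
  choose t ht using fun i => (h i).out
  exact ⟨BoundedArith.app s t, fun x => by simp only [realize_app, ht]⟩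

theorem DefFun.app₁ (s : PVSym 1) (f : M → M) [hf : DefFun f] :
    DefFun fun x => fn s ![f x] := by
  have := DefFun.app s ![f] (fun i => by fin_cases i; exact hf)
  convert this using 3 with x
  funext i; fin_cases i; rfl

theorem DefFun.app₂ (s : PVSym 2) (f g : M → M) [hf : DefFun f] [hg : DefFun g] :
    DefFun fun x => fn s ![f x, g x] := by
  have := DefFun.app s ![f, g] (fun i => by fin_cases i; exacts [hf, hg])
  convert this using 3 with x
  funext i; fin_cases i <;> rfl

theorem DefFun.app₃ (s : PVSym 3) (f g h : M → M) [hf : DefFun f] [hg : DefFun g]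
    [hh : DefFun h] : DefFun fun x => fn s ![f x, g x, h x] := by
  have := DefFun.app s ![f, g, h] (fun i => by fin_cases i; exacts [hf, hg, hh])
  convert this using 3 with x
  funext i; fin_cases i <;> rfl

section

variable (f g : M → M) [hf : DefFun f] [hg : DefFun g]

instance DefFun.half : DefFun fun x => BoundedArith.hf (f x) := DefFun.app₁ _ _
instance DefFun.ln : DefFun fun x => ln (f x) := DefFun.app₁ _ _
instance DefFun.add : DefFun fun x => f x + g x := DefFun.app₂ _ _ _
instance DefFun.mul : DefFun fun x => f x * g x := DefFun.app₂ _ _ _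
instance DefFun.sm : DefFun fun x => sm (f x) (g x) := DefFun.app₂ _ _ _

instance DefPred.eq : DefPred fun x => f x = g x := by
  obtain ⟨t, ht⟩ := hf.out
  obtain ⟨u, hu⟩ := hg.out
  exact ⟨t.equal u, (BoundedFormula.IsAtomic.equal _ _).isQF, fun x => by
    rw [Formula.realize_equal, ht, hu]⟩

instance DefPred.le : DefPred fun x => f x ≤ g x := by
  obtain ⟨t, ht⟩ := hf.out
  obtain ⟨u, hu⟩ := hg.out
  refine ⟨Relations.formula₂ (L := PV) PVRel.le t u,
    (BoundedFormula.IsAtomic.rel _ _).isQF, fun x => ?_⟩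
  rw [← ht, ← hu]
  exact Formula.realize_rel₂ (L := PV) (R := PVRel.le)

end

section

variable (P Q : M → Prop) [hP : DefPred P] [hQ : DefPred Q]

instance DefPred.imp : DefPred fun x => P x → Q x := by
  obtain ⟨φ, h, hφ⟩ := hP.out
  obtain ⟨ψ, h', hψ⟩ := hQ.out
  exact ⟨φ.imp ψ, h.imp h', fun x => by rw [Formula.realize_imp, hφ, hψ]⟩

instance DefPred.not : DefPred fun x => ¬ P x := by
  obtain ⟨φ, h, hφ⟩ := hP.out
  exact ⟨φ.not, h.not, fun x => by rw [Formula.realize_not, hφ]⟩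

instance DefPred.and : DefPred fun x => P x ∧ Q x := by
  obtain ⟨φ, h, hφ⟩ := hP.out
  obtain ⟨ψ, h', hψ⟩ := hQ.out
  exact ⟨φ ⊓ ψ, h.inf h', fun x => by rw [Formula.realize_inf, hφ, hψ]⟩

instance DefPred.or : DefPred fun x => P x ∨ Q x := by
  obtain ⟨φ, h, hφ⟩ := hP.out
  obtain ⟨ψ, h', hψ⟩ := hQ.out
  exact ⟨φ ⊔ ψ, h.sup h', fun x => by rw [Formula.realize_sup, hφ, hψ]⟩

end

instance DefPred.ne (f g : M → M) [DefFun f] [DefFun g] : DefPred fun x => f x ≠ g x :=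
  DefPred.not _

/-! Eta-reduced forms of the previous instances. -/

instance DefFun.half' : DefFun (BoundedArith.hf (M := M)) := DefFun.half _
instance DefFun.ln' : DefFun (BoundedArith.ln (M := M)) := DefFun.ln _
instance DefFun.sm' (a : M) : DefFun (BoundedArith.sm a) := DefFun.sm (fun _ => a) _

/-- The induction axioms concern open formulas in finitely many variables. A formula with parameters
from `M` is brought into this form by keeping only the variables that occur, and it has to stay
open. -/
theorem isQF_restrictFreeVar {α β : Type} [DecidableEq α] {n : ℕ} {φ : PV.BoundedFormula α n}
    (h : φ.IsQF) (f : φ.freeVarFinset → β) : (φ.restrictFreeVar f).IsQF := by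
  induction h with
  | falsum => exact .falsum
  | of_isAtomic h =>
    cases h with
    | equal => exact (BoundedFormula.IsAtomic.equal _ _).isQF
    | rel => exact (BoundedFormula.IsAtomic.rel _ _).isQF
  | imp _ _ h₁ h₂ => exact (h₁ _).imp (h₂ _)

/-- An open property with parameters is given by an open formula with finitely many variables. -/
theorem DefPred.exists_fin (P : M → Prop) [hP : DefPred P] :
    ∃ (n : ℕ) (φ : PV.Formula (Fin (n + 1))) (c : Fin n → M), φ.IsQF ∧
      ∀ x, φ.Realize (Fin.cons x c) ↔ P x := by
  classical
  obtain ⟨φ, h, hφ⟩ := hP.out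
  let e := φ.freeVarFinset.equivFin
  -- The induction variable `none` becomes variable `0`, and each parameter becomes a later variable
  -- with its own value. If `none` occurs, its slot in the enumeration receives the dummy value `0`,
  -- which the formula never reads.
  refine ⟨φ.freeVarFinset.card, φ.restrictFreeVar fun a => if a.1 = none then 0 else (e a).succ,
    fun i => (e.symm i).1.elim 0 id, isQF_restrictFreeVar h _, fun x => ?_⟩
  rw [← hφ x]
  refine BoundedFormula.realize_restrictFreeVar _ fun a => ?_
  rcases a with ⟨_ | a, ha⟩ <;> simp

theorem realize_inst {n m : ℕ} (φ : PV.Formula (Fin (n + 1))) (t : Tm m) (ts : Fin n → Tm m)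
    (v : Empty → M) (xs : Fin m → M) :
    (inst φ t ts).Realize v xs ↔ φ.Realize
      (Fin.cons (t.realize (Sum.elim v xs)) fun i => (ts i).realize (Sum.elim v xs)) := by
  rw [inst, BoundedFormula.realize_relabel, BoundedFormula.realize_subst, Formula.Realize]
  congr! 1
  funext i
  refine Fin.cases ?_ (fun i => ?_) i <;> rfl

/-- Polynomial induction. -/
theorem pind_fn (P : M → Prop) [DefPred P] (h0 : P 0) (hs : ∀ x, P (hf x) → P x) (x : M) :
    P x := by
  obtain ⟨n, φ, c, h, hφ⟩ := DefPred.exists_fin P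
  have key : M ⊨ pind φ := Theory.realize_sentence_of_mem PV₁ (Or.inr ⟨n, φ, h, rfl⟩)
  have := BoundedFormula.realize_alls.1 key c
  simp only [BoundedFormula.realize_imp, BoundedFormula.realize_inf, BoundedFormula.realize_all,
    realize_inst, realize_zero, realize_half, realize_vars] at this
  have hsnoc : ∀ a : M, (fun i : Fin n => Term.realize (Sum.elim (default : Empty → M)
      (Fin.snoc c a : Fin (n + 1) → M)) (&i.castSucc : Tm (n + 1))) = c := by
    intro a; funext i; simp
  have hlast : ∀ a : M, Term.realize (Sum.elim (default : Empty → M)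
      (Fin.snoc c a : Fin (n + 1) → M)) (&(Fin.last n) : Tm (n + 1)) = a := by
    intro a; simp
  simp only [hsnoc, hlast, hφ] at this
  exact this ⟨h0, hs⟩ x

end Semantics

/-! ### The ordered semiring structure of a model -/

section OrderedSemiring

variable {M : PV₁.ModelType.{0, 0, 0}}

/-- Buss's axioms hold in a model of `PV₁`. -/
theorem basic_laws (x y z v : M) :
    (y ≤ x → y ≤ suc x) ∧
    x ≠ suc x ∧
    0 ≤ x ∧
    ((x ≤ y ∧ x ≠ y) ↔ suc x ≤ y) ∧
    (x ≠ 0 → suc 1 * x ≠ 0) ∧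
    (y ≤ x ∨ x ≤ y) ∧
    (x ≤ y ∧ y ≤ x → x = y) ∧
    (x ≤ y ∧ y ≤ z → x ≤ z) ∧
    ln (0 : M) = 0 ∧
    (x ≠ 0 → ln (suc 1 * x) = suc (ln x) ∧ ln (suc (suc 1 * x)) = suc (ln x)) ∧
    ln (1 : M) = 1 ∧
    (x ≤ y → ln x ≤ ln y) ∧
    ln (sm x y) = suc (ln x * ln y) ∧
    sm 0 y = 1 ∧
    (x ≠ 0 → sm 1 (suc 1 * x) = suc 1 * sm 1 x ∧ sm 1 (suc (suc 1 * x)) = suc 1 * sm 1 x) ∧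
    sm x y = sm y x ∧
    (ln x = ln y → sm x z = sm y z) ∧
    (ln x = ln z + ln v → sm x y = sm z y * sm v y) ∧
    x ≤ x + y ∧
    (x ≤ y ∧ x ≠ y → suc (suc 1 * x) ≤ suc 1 * y ∧ suc (suc 1 * x) ≠ suc 1 * y) ∧
    x + y = y + x ∧
    x + 0 = x ∧
    x + suc y = suc (x + y) ∧
    x + y + z = x + (y + z) ∧
    (x + y ≤ x + z ↔ y ≤ z) ∧
    x * 0 = 0 ∧
    x * suc y = x * y + x ∧
    x * y = y * x ∧
    x * (y + z) = x * y + x * z ∧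
    (1 ≤ x → (x * y ≤ x * z ↔ y ≤ z)) ∧
    (x ≠ 0 → ln x = suc (ln (hf x))) ∧
    (x = hf y ↔ (suc 1 * x = y ∨ suc (suc 1 * x) = y)) := by
  have h := fun φ (h : φ ∈ basicFormulas) => realize_basic (M := M) h ![x, y, z, v]
  have h0 : Term.realize (Sum.elim default ![x, y, z, v]) (&0 : Tm 4) = x := rfl
  have h1 : Term.realize (Sum.elim default ![x, y, z, v]) (&1 : Tm 4) = y := rfl
  have h2 : Term.realize (Sum.elim default ![x, y, z, v]) (&2 : Tm 4) = z := rfl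
  have h3 : Term.realize (Sum.elim default ![x, y, z, v]) (&3 : Tm 4) = v := rfl
  simp only [basicFormulas, Set.mem_insert_iff, forall_eq_or_imp, Set.mem_singleton_iff, forall_eq,
    BoundedFormula.realize_imp, BoundedFormula.realize_iff, BoundedFormula.realize_inf,
    BoundedFormula.realize_sup, BoundedFormula.realize_bdEqual,
    realize_le, realize_ne, realize_S, realize_add, realize_mul, realize_dbl, realize_len,
    realize_smash, realize_half, realize_zero, realize_one, h0, h1, h2, h3] at h
  exact h

theorem one_eq_suc : (1 : M) = suc 0 := rfl

theorem suc_eq (x : M) : suc x = x + 1 := by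
  obtain ⟨-, -, -, -, -, -, -, -, -, -, -, -, -, -, -, -, -, -, -, -, -, h, h', -⟩ :=
    basic_laws x 0 0 0
  rw [one_eq_suc, h', h]

noncomputable instance : LinearOrder M where
  le_refl x := by
    obtain ⟨-, -, -, -, -, h, -⟩ := basic_laws x x 0 0
    tauto
  le_trans x y z h₁ h₂ := by
    obtain ⟨-, -, -, -, -, -, -, h, -⟩ := basic_laws x y z 0
    exact h ⟨h₁, h₂⟩
  le_antisymm x y h₁ h₂ := by
    obtain ⟨-, -, -, -, -, -, h, -⟩ := basic_laws x y 0 0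
    exact h ⟨h₁, h₂⟩
  le_total x y := by
    obtain ⟨-, -, -, -, -, h, -⟩ := basic_laws x y 0 0
    tauto
  toDecidableLE := Classical.decRel _

instance : AddCommMonoid M where
  add_comm x y := by
    obtain ⟨-, -, -, -, -, -, -, -, -, -, -, -, -, -, -, -, -, -, -, -, h, -⟩ :=
      basic_laws x y 0 0
    exact h
  add_assoc x y z := by
    obtain ⟨-, -, -, -, -, -, -, -, -, -, -, -, -, -, -, -, -, -, -, -, -, -, -, h, -⟩ :=
      basic_laws x y z 0
    exact h
  add_zero x := by
    obtain ⟨-, -, -, -, -, -, -, -, -, -, -, -, -, -, -, -, -, -, -, -, -, h, -⟩ :=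
      basic_laws x 0 0 0
    exact h
  zero_add x := by
    obtain ⟨-, -, -, -, -, -, -, -, -, -, -, -, -, -, -, -, -, -, -, -, h, h', -⟩ :=
      basic_laws x 0 0 0
    rw [← h, h']
  nsmul := nsmulRec

theorem mul_laws (x y z : M) : x * 0 = 0 ∧ x * (y + 1) = x * y + x ∧ x * y = y * x ∧
    x * (y + z) = x * y + x * z ∧ (1 ≤ x → (x * y ≤ x * z ↔ y ≤ z)) := by
  obtain ⟨-, -, -, -, -, -, -, -, -, -, -, -, -, -, -, -, -, -, -, -, -, -, -, -, -,
    h₁, h₂, h₃, h₄, h₅, -⟩ := basic_laws x y z 0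
  rw [suc_eq] at h₂
  exact ⟨h₁, h₂, h₃, h₄, h₅⟩

theorem suc_one_mul (x : M) : suc 1 * x = x + x := by
  have h := mul_laws x
  rw [suc_eq, (mul_laws _ x 0).2.2.1, (h 1 0).2.1]
  have := (h 0 0).2.1
  rw [zero_add, (h 0 0).1, zero_add] at this
  rw [this]

theorem half_cases (x : M) : hf x + hf x = x ∨ hf x + hf x + 1 = x := by
  obtain ⟨-, -, -, -, -, -, -, -, -, -, -, -, -, -, -, -, -, -, -, -, -, -, -, -, -,
    -, -, -, -, -, -, h⟩ := basic_laws (hf x) x 0 0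
  rwa [suc_one_mul, suc_eq, eq_self_iff_true, true_iff] at h

instance : CommSemiring M where
  left_distrib x y z := (mul_laws x y z).2.2.2.1
  right_distrib x y z := by
    rw [(mul_laws _ z 0).2.2.1, (mul_laws z x y).2.2.2.1, (mul_laws z x 0).2.2.1,
      (mul_laws z y 0).2.2.1]
  zero_mul x := by rw [(mul_laws _ x 0).2.2.1, (mul_laws x x 0).1]
  mul_zero x := (mul_laws x x 0).1
  mul_comm x y := (mul_laws x y 0).2.2.1
  mul_one x := by
    have := (mul_laws x 0 0).2.1
    rwa [zero_add, (mul_laws x x 0).1, zero_add] at this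
  one_mul x := by
    have := (mul_laws x 0 0).2.1
    rwa [zero_add, (mul_laws x x 0).1, zero_add, (mul_laws x 1 0).2.2.1] at this
  mul_assoc x y z := by
    have h0 : ∀ x : M, 0 * x = 0 := fun x => by
      rw [(mul_laws _ x 0).2.2.1, (mul_laws x x 0).1]
    have hd : ∀ x y z : M, (x + y) * z = x * z + y * z := fun x y z => by
      rw [(mul_laws _ z 0).2.2.1, (mul_laws z x y).2.2.2.1, (mul_laws z x 0).2.2.1,
        (mul_laws z y 0).2.2.1]
    have h1 : ∀ x : M, 1 * x = x := fun x => by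
      have := (mul_laws x 0 0).2.1
      rwa [zero_add, (mul_laws x x 0).1, zero_add, (mul_laws x 1 0).2.2.1] at this
    -- Associativity of multiplication is not a BASIC axiom. Writing `x` as `h + h` or `h + h + 1`
    -- reduces it to `h` by distributivity.
    refine pind_fn (fun x => x * y * z = x * (y * z)) ?_ (fun x ih => ?_) x
    · simp only [h0]
    · rcases half_cases x with h | h
      · rw [← h, hd, hd, hd, ih]
      · rw [← h, hd, hd, hd, hd, hd, hd, h1, h1, ih]

noncomputable instance : SuccOrder M := SuccOrder.ofSuccLeIff suc fun {x y} => by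
  obtain ⟨-, -, -, h, -⟩ := basic_laws x y 0 0
  rw [← h, lt_iff_le_and_ne]

/-- Discreteness in the form `a < b ↔ a + 1 ≤ b`. Strict inequalities are put in this form before an
induction or an appeal to linear arithmetic. -/
noncomputable instance : SuccAddOrder M := ⟨fun x => suc_eq x⟩

instance : NoMaxOrder M := ⟨fun x => ⟨suc x, by
  obtain ⟨h, h', -⟩ := basic_laws x x 0 0
  exact lt_of_le_of_ne (h le_rfl) h'⟩⟩

theorem nonneg (x : M) : 0 ≤ x := (basic_laws x 0 0 0).2.2.1

instance : IsStrictOrderedRing M where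
  add_le_add_left x y h z := by
    obtain ⟨-, -, -, -, -, -, -, -, -, -, -, -, -, -, -, -, -, -, -, -, -, -, -, -, h', -⟩ :=
      basic_laws z x y 0
    rw [add_comm x, add_comm y]
    exact h'.2 h
  le_of_add_le_add_left z x y h := by
    obtain ⟨-, -, -, -, -, -, -, -, -, -, -, -, -, -, -, -, -, -, -, -, -, -, -, -, h', -⟩ :=
      basic_laws z x y 0
    exact h'.1 h
  zero_le_one := nonneg _
  exists_pair_ne := ⟨0, 1, by
    have := (basic_laws (0 : M) 0 0 0).2.1
    rwa [suc_eq, zero_add] at this⟩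
  mul_lt_mul_of_pos_left z hz x y h := by
    have := (mul_laws z y x).2.2.2.2 (by rwa [← Order.add_one_le_iff, zero_add] at hz)
    exact lt_of_not_ge fun h' => not_le_of_gt h (this.1 h')
  mul_lt_mul_of_pos_right z hz x y h := by
    have := (mul_laws z y x).2.2.2.2 (by rwa [← Order.add_one_le_iff, zero_add] at hz)
    rw [mul_comm x, mul_comm y]
    exact lt_of_not_ge fun h' => not_le_of_gt h (this.1 h')

theorem eq_half_iff {x y : M} : x = hf y ↔ x + x = y ∨ x + x + 1 = y := by
  obtain ⟨-, -, -, -, -, -, -, -, -, -, -, -, -, -, -, -, -, -, -, -, -, -, -, -, -,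
    -, -, -, -, -, -, h⟩ := basic_laws x y 0 0
  rwa [suc_one_mul, suc_eq] at h

theorem half_add_half_le (x : M) : hf x + hf x ≤ x := by
  have := half_cases x; have := zero_lt_one (α := M); grind

theorem le_half_add_half (x : M) : x ≤ hf x + hf x + 1 := by
  have := half_cases x; have := zero_lt_one (α := M); grind

theorem half_le (x : M) : hf x ≤ x := by
  have := half_add_half_le x; have := nonneg (hf x); grind

@[simp] theorem half_zero : hf (0 : M) = 0 := (eq_half_iff.2 (by simp)).symm

@[simp] theorem half_two : hf (2 : M) = 1 := (eq_half_iff.2 (by norm_num)).symm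

theorem half_add_half_add_one (x : M) : hf (x + x + 1) = x := (eq_half_iff.2 (by simp)).symm

/-- Polynomial induction. -/
theorem pind_open (P : M → Prop) [DefPred P] (h0 : P 0) (hs : ∀ x, x ≠ 0 → P (hf x) → P x)
    (x : M) : P x :=
  pind_fn P h0 (fun x h => if hx : x = 0 then hx ▸ h0 else hs x hx h) x

/-! ### The length and smash functions -/

@[simp] theorem ln_zero : ln (0 : M) = 0 := (basic_laws 0 0 0 0).2.2.2.2.2.2.2.2.1

@[simp] theorem ln_one : ln (1 : M) = 1 := (basic_laws 0 0 0 0).2.2.2.2.2.2.2.2.2.2.1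

theorem ln_mono {x y : M} (h : x ≤ y) : ln x ≤ ln y :=
  (basic_laws x y 0 0).2.2.2.2.2.2.2.2.2.2.2.1 h

theorem ln_of_ne {x : M} (h : x ≠ 0) : ln x = ln (hf x) + 1 := by
  obtain ⟨-, -, -, -, -, -, -, -, -, -, -, -, -, -, -, -, -, -, -, -, -, -, -, -, -,
    -, -, -, -, -, h', -⟩ := basic_laws x 0 0 0
  rw [h' h, suc_eq]

theorem ln_eq_zero {x : M} : ln x = 0 ↔ x = 0 := by
  refine ⟨fun h => ?_, fun h => h ▸ ln_zero⟩
  by_contra hx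
  have := ln_of_ne hx
  have := nonneg (ln (hf x))
  have := zero_lt_one (α := M)
  grind

theorem one_le_iff {x : M} : 1 ≤ x ↔ x ≠ 0 := by
  rw [← zero_add (1 : M), Order.add_one_le_iff, lt_iff_le_and_ne]
  exact ⟨fun h => h.2.symm, fun h => ⟨nonneg x, h.symm⟩⟩

theorem ln_le_self (x : M) : ln x ≤ x := by
  refine pind_open (fun x => ln x ≤ x) (by simp) (fun x hx ih => ?_) x
  rw [ln_of_ne hx]
  have h := half_cases x
  by_cases h0 : hf x = 0
  · rw [h0, ln_zero, zero_add]; exact one_le_iff.2 hx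
  · have := one_le_iff.2 h0
    have := zero_lt_one (α := M)
    grind

theorem ln_sm (x y : M) : ln (sm x y) = ln x * ln y + 1 := by
  have := (basic_laws x y 0 0).2.2.2.2.2.2.2.2.2.2.2.2.1
  rwa [suc_eq] at this

@[simp] theorem sm_zero_left (y : M) : sm 0 y = 1 :=
  (basic_laws 0 y 0 0).2.2.2.2.2.2.2.2.2.2.2.2.2.1

theorem sm_comm (x y : M) : sm x y = sm y x :=
  (basic_laws x y 0 0).2.2.2.2.2.2.2.2.2.2.2.2.2.2.2.1

theorem sm_congr {x y : M} (z : M) (h : ln x = ln y) : sm x z = sm y z :=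
  (basic_laws x y z 0).2.2.2.2.2.2.2.2.2.2.2.2.2.2.2.2.1 h

theorem sm_of_ne {x : M} (y : M) (h : x ≠ 0) : sm x y = sm (hf x) y * sm 1 y :=
  (basic_laws x y (hf x) 1).2.2.2.2.2.2.2.2.2.2.2.2.2.2.2.2.2.1 (by rw [ln_of_ne h, ln_one])

theorem sm_ne_zero (x y : M) : sm x y ≠ 0 := by
  rw [ne_eq, ← ln_eq_zero, ln_sm, ← ne_eq, ← one_le_iff]
  have := nonneg (ln x * ln y)
  grind

/-- One axiom gives `1 # 2 = 2 · (1 # 1)`, and splitting `|2| = |1| + |1|` gives `2 # 1 = (1 # 1)²`.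
By symmetry of `#` the nonzero factor `1 # 1` cancels. -/
theorem sm_one_one : sm (1 : M) 1 = 2 := by
  have h := (basic_laws (1 : M) 0 0 0).2.2.2.2.2.2.2.2.2.2.2.2.2.2.1 one_ne_zero
  have h2 : (2 : M) ≠ 0 := two_ne_zero
  have := sm_of_ne (1 : M) h2
  rw [half_two, sm_comm] at this
  rw [suc_one_mul, suc_eq, one_add_one_eq_two, this] at h
  rcases (nonneg (sm (1 : M) 1)).lt_or_eq with h' | h'
  · rcases lt_trichotomy (sm (1 : M) 1) 2 with h'' | h'' | h''
    · exact absurd h.1 (mul_lt_mul_of_pos_right h'' h').ne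
    · exact h''
    · exact absurd h.1 (mul_lt_mul_of_pos_right h'' h').ne'
  · exact absurd h'.symm (sm_ne_zero _ _)

theorem sm_one_of_ne {x : M} (h : x ≠ 0) : sm 1 x = 2 * sm 1 (hf x) := by
  rw [sm_comm, sm_of_ne 1 h, sm_one_one, sm_comm, mul_comm]

theorem lt_sm_one (x : M) : x < sm 1 x := by
  rw [← Order.add_one_le_iff]
  refine pind_open (fun x => x + 1 ≤ sm 1 x) (by simp [sm_comm 1 (0 : M)]) (fun x hx ih => ?_) x
  rw [sm_one_of_ne hx, two_mul]
  have := le_half_add_half x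
  grind

theorem one_le_sm (x y : M) : 1 ≤ sm x y := one_le_iff.2 (sm_ne_zero x y)

end OrderedSemiring

/-! ### Evaluation of PV symbols and limited recursion -/

section Symbols

variable {M : PV₁.ModelType.{0, 0, 0}}

@[simp] theorem fn_add (x y : M) : fn .add ![x, y] = x + y := rfl
@[simp] theorem fn_mul (x y : M) : fn .mul ![x, y] = x * y := rfl
@[simp] theorem fn_smash (x y : M) : fn .smash ![x, y] = sm x y := rfl
@[simp] theorem fn_len (x : M) : fn .len ![x] = ln x := rfl
@[simp] theorem fn_half (x : M) : fn .half ![x] = hf x := rfl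
@[simp] theorem fn_succ (x : M) : fn .succ ![x] = x + 1 := suc_eq x

theorem fn_leq (x y : M) : fn .leq ![x, y] = if x ≤ y then (1 : M) else 0 := by
  split_ifs with h
  exacts [fn_leq_one h, fn_leq_zero h]

theorem fn_comp₀ {n : ℕ} (f : PVSym 0) (xs : Fin n → M) :
    fn (.comp f ![]) xs = fn f ![] := by
  rw [fn_comp]; congr 1; exact Subsingleton.elim _ _

@[simp] theorem fn_comp₁ {n : ℕ} (f : PVSym 1) (g : PVSym n) (xs : Fin n → M) :
    fn (.comp f ![g]) xs = fn f ![fn g xs] := by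
  rw [fn_comp]; congr 1; funext i; fin_cases i; rfl

@[simp] theorem fn_comp₂ {n : ℕ} (f : PVSym 2) (g h : PVSym n) (xs : Fin n → M) :
    fn (.comp f ![g, h]) xs = fn f ![fn g xs, fn h xs] := by
  rw [fn_comp]; congr 1; funext i; fin_cases i <;> rfl

@[simp] theorem fn_comp₃ {n : ℕ} (f : PVSym 3) (g h k : PVSym n) (xs : Fin n → M) :
    fn (.comp f ![g, h, k]) xs = fn f ![fn g xs, fn h xs, fn k xs] := by
  rw [fn_comp]; congr 1; funext i; fin_cases i <;> rfl

@[simp] theorem fn_const0 {n : ℕ} (xs : Fin n → M) : fn (.const0 n) xs = 0 := fn_comp₀ _ _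

@[simp] theorem fn_const1 {n : ℕ} (xs : Fin n → M) : fn (.const1 n) xs = 1 := by
  rw [PVSym.const1, fn_comp₁, fn_const0]; rfl

attribute [simp] fn_proj

theorem fn_limRec_eq {n : ℕ} {g : PVSym n} {h : PVSym (n + 2)} {k : PVSym (n + 1)}
    {x : M} (hx : x ≠ 0) (xs : Fin n → M) {r a : M}
    (hr : fn (.limRec g h k) (Matrix.vecCons (hf x) xs) = r)
    (ha : fn h (Matrix.vecCons x (Matrix.vecCons r xs)) = a)
    (hle : a ≤ fn k (Matrix.vecCons x xs)) :
    fn (.limRec g h k) (Matrix.vecCons x xs) = a := by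
  subst hr ha
  exact (fn_limRec_step g h k hx xs).1 hle

/-- The minimum in the scheme makes the bound hold unconditionally. Applied to the value at `⌊x/2⌋`,
it often shows that the step value at `x` respects the bound, so that `fn_limRec_eq` yields the
intended recursion. -/
theorem fn_limRec_le {n : ℕ} {g : PVSym n} {h : PVSym (n + 2)} {k : PVSym (n + 1)}
    {x : M} (hx : x ≠ 0) (xs : Fin n → M) :
    fn (.limRec g h k) (Matrix.vecCons x xs) ≤ fn k (Matrix.vecCons x xs) := by
  obtain ⟨h₁, h₂⟩ := fn_limRec_step g h k hx xs
  by_cases hle : fn h (Fin.cons x (Fin.cons (fn (.limRec g h k) (Fin.cons (hf x) xs)) xs)) ≤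
      fn k (Fin.cons x xs)
  · exact (h₁ hle).trans_le hle
  · exact (h₂ hle).le

theorem fn_limRec_zero' {n : ℕ} (g : PVSym n) (h : PVSym (n + 2)) (k : PVSym (n + 1))
    (xs : Fin n → M) : fn (.limRec g h k) (Matrix.vecCons 0 xs) = fn g xs :=
  fn_limRec_zero g h k xs

theorem le_add_nonneg_right (x y : M) : x ≤ x + y := le_add_of_nonneg_right (nonneg y)

theorem le_add_nonneg_left (x y : M) : y ≤ x + y := le_add_of_nonneg_left (nonneg x)

theorem fn_cond (b u v : M) : fn .cond ![b, u, v] = if b = 0 then v else u := by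
  split_ifs with h
  · rw [h, PVSym.cond, fn_limRec_zero']; simp
  · exact fn_limRec_eq h ![u, v] rfl (by simp) (by simpa using nonneg v)

theorem fn_cond_leq (x y u v : M) :
    fn .cond ![fn .leq ![x, y], u, v] = if x ≤ y then u else v := by
  rw [fn_cond, fn_leq]
  split_ifs <;> simp_all

/-! ### Subtraction -/

/-- `shr (z, y)` is `y` with the last `|z|` binary digits deleted. -/
def PVSym.shr : PVSym 2 := limRec (proj 0) (comp half ![proj 1]) (proj 1)

/-- `subSearch (z, x, y)` is the result of `|z|` rounds of a binary search for `y - x`. -/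
def PVSym.subSearch : PVSym 3 :=
  limRec (const0 2)
    (comp cond ![
      comp leq ![comp add ![proj 2, comp add ![proj 1, comp succ ![comp shr ![proj 0, proj 3] ] ] ],
        proj 3],
      comp add ![proj 1, comp succ ![comp shr ![proj 0, proj 3] ] ],
      proj 1])
    (proj 2)

/-- The value of `PVSym.shr`. -/
def shr (z y : M) : M := fn .shr ![z, y]

instance (f g : M → M) [DefFun f] [DefFun g] : DefFun fun x => shr (f x) (g x) :=
  DefFun.app₂ _ _ _

theorem fn_shr (z y : M) : fn .shr ![z, y] = shr z y := rfl

theorem shr_zero (y : M) : shr 0 y = y := by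
  rw [shr, PVSym.shr, fn_limRec_zero']; simp

theorem shr_le (z y : M) : shr z y ≤ y := by
  by_cases h : z = 0
  · rw [h, shr_zero]
  · exact (fn_limRec_le h _).trans (by simp)

theorem shr_of_ne {z : M} (h : z ≠ 0) (y : M) : shr z y = hf (shr (hf z) y) := by
  exact fn_limRec_eq h ![y] (r := shr (hf z) y) rfl (by simp)
    (by simpa using (half_le _).trans (shr_le (hf z) y))

theorem shr_self (y : M) : shr y y = 0 := by
  -- Every halving of a nonzero number shortens it by one digit, so after `|y|` halvings no digit is
  -- left.
  have key := fun z => pind_open (fun z => shr z y = 0 ∨ ln (shr z y) + ln z ≤ ln y)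
    (by simp [shr_zero]) (fun z hz ih => ?_) z
  · rcases key y with h | h
    · exact h
    · rw [← ln_eq_zero]
      exact le_antisymm (by grind) (nonneg _)
  · rw [shr_of_ne hz, ln_of_ne hz]
    by_cases h0 : shr (hf z) y = 0
    · simp [h0]
    · right
      rw [ln_of_ne h0] at ih
      grind

/-- The value of `PVSym.subSearch`. -/
def subSearch (z x y : M) : M := fn .subSearch ![z, x, y]

instance (f g h : M → M) [DefFun f] [DefFun g] [DefFun h] :
    DefFun fun x => subSearch (f x) (g x) (h x) := DefFun.app₃ _ _ _ _

theorem subSearch_zero (x y : M) : subSearch 0 x y = 0 := by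
  rw [subSearch, PVSym.subSearch, fn_limRec_zero']; simp

theorem subSearch_le (z x y : M) : subSearch z x y ≤ y := by
  by_cases h : z = 0
  · rw [h, subSearch_zero]; exact nonneg y
  · exact (fn_limRec_le h _).trans (by simp)

theorem subSearch_of_ne {z : M} (h : z ≠ 0) (x y : M) : subSearch z x y =
    if x + (subSearch (hf z) x y + (shr z y + 1)) ≤ y then subSearch (hf z) x y + (shr z y + 1)
    else subSearch (hf z) x y := by
  refine fn_limRec_eq h ![x, y] (r := subSearch (hf z) x y) rfl
    (by simp [fn_cond_leq, fn_shr]) ?_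
  simp only [fn_proj]
  split_ifs with hle
  · exact (le_add_nonneg_left _ _).trans hle
  · exact subSearch_le _ _ _

/-- Invariant of the binary search: the error is at most `shr z y`. If the old error bound is `e ≤
2h + 1` with `h = ⌊e/2⌋`, the search tries to add `h + 1`. Whether this succeeds or overshoots, the
remaining error is at most `h`. -/
theorem subSearch_spec {x y : M} (h : x ≤ y) (z : M) :
    x + subSearch z x y ≤ y ∧ y ≤ x + subSearch z x y + shr z y := by
  refine pind_open (fun z => x + subSearch z x y ≤ y ∧ y ≤ x + subSearch z x y + shr z y)
    ?_ (fun z hz ih => ?_) z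
  · rw [subSearch_zero, shr_zero, add_zero]
    exact ⟨h, le_add_nonneg_left _ _⟩
  · have h₁ := half_cases (shr (hf z) y)
    have h₂ := zero_lt_one (α := M)
    rw [← shr_of_ne hz] at h₁
    rw [subSearch_of_ne hz]
    split_ifs with hle
    · exact ⟨hle, by grind⟩
    · rw [not_le, ← Order.add_one_le_iff] at hle
      exact ⟨ih.1, by grind⟩

/-- Differences exist because after `|y|` rounds of the search the error bound `shr y y` is `0`. -/
instance : CanonicallyOrderedAdd M where
  exists_add_of_le {x y} h := ⟨subSearch y x y, by
    have := subSearch_spec h y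
    rw [shr_self, add_zero] at this
    exact le_antisymm this.2 this.1⟩
  le_add_self x y := le_add_nonneg_left y x
  le_self_add x y := le_add_nonneg_right x y

end Symbols

section LegendreSymbols

variable {M : PV₁.ModelType.{0, 0, 0}}

/-! ### Division and divisibility -/

/-- The value of `PVSym.div`. -/
def quo (x m : M) : M := fn .div ![x, m]

instance (f g : M → M) [DefFun f] [DefFun g] : DefFun fun x => quo (f x) (g x) :=
  DefFun.app₂ _ _ _

theorem fn_div (x m : M) : fn .div ![x, m] = quo x m := rfl

theorem quo_zero (m : M) : quo 0 m = 0 := by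
  rw [quo, PVSym.div, fn_limRec_zero']; simp

theorem quo_le (x m : M) : quo x m ≤ x := by
  by_cases h : x = 0
  · rw [h, quo_zero]
  · exact (fn_limRec_le h _).trans (by simp)

/-- The long division step. -/
theorem quo_of_ne {x m : M} (hm : m ≠ 0) (h : x ≠ 0) (hle : m * quo (hf x) m ≤ hf x) :
    quo x m = if m * (quo (hf x) m + quo (hf x) m + 1) ≤ x
      then quo (hf x) m + quo (hf x) m + 1 else quo (hf x) m + quo (hf x) m := by
  refine fn_limRec_eq h ![m] (r := quo (hf x) m) rfl
    (by simp [fn_cond_leq]) ?_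
  -- As `m ≥ 1`, a value `v` satisfies `v ≤ m v`, so the bound `x` of the recursion is respected.
  have hm' := fun y : M => le_mul_of_one_le_left (nonneg y) (one_le_iff.2 hm)
  simp only [fn_proj]
  change _ ≤ x
  split_ifs with h'
  · exact (hm' _).trans h'
  · exact (add_le_add ((hm' _).trans hle) ((hm' _).trans hle)).trans (half_add_half_le x)

/-- With `q` the quotient of `⌊x/2⌋`, doubling `m q ≤ ⌊x/2⌋ < m (q + 1)` gives `2 m q ≤ x < 2 m (q +
1)`. The comparison with `m (2 q + 1)` chooses the correct half of this interval. -/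
theorem quo_spec {m : M} (hm : m ≠ 0) (x : M) : m * quo x m ≤ x ∧ x < m * (quo x m + 1) := by
  rw [← Order.add_one_le_iff]
  refine pind_open (fun x => m * quo x m ≤ x ∧ x + 1 ≤ m * (quo x m + 1)) ?_
    (fun x hx ih => ?_) x
  · rw [quo_zero]
    simpa using one_le_iff.2 hm
  · have h₁ := half_cases x
    have h₂ := zero_lt_one (α := M)
    rw [quo_of_ne hm hx ih.1]
    set q := quo (hf x) m
    -- Expanded in this way, all inequalities are linear in `m * q`, `m` and `x`.
    have e₁ : m * (q + 1) = m * q + m := by ring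
    have e₂ : m * (q + q) = m * q + m * q := by ring
    have e₃ : m * (q + q + 1) = m * q + m * q + m := by ring
    have e₄ : m * (q + q + 1 + 1) = m * q + m * q + m + m := by ring
    rw [e₁] at ih
    split_ifs with hle
    · rw [e₄]
      exact ⟨hle, by grind⟩
    · rw [not_le, ← Order.add_one_le_iff] at hle
      rw [e₂]
      exact ⟨by grind, hle⟩

theorem quo_eq {m x q r : M} (h : x = m * q + r) (hr : r < m) : quo x m = q := by
  have hm : m ≠ 0 := by rintro rfl; exact not_lt_of_ge (nonneg r) hr
  have hm' : 0 < m := pos_iff_ne_zero.2 hm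
  obtain ⟨h₁, h₂⟩ := quo_spec hm x
  apply le_antisymm
  · rw [← Order.lt_add_one_iff]
    refine lt_of_mul_lt_mul_left (h₁.trans_lt ?_) hm'.le
    rw [h, mul_add_one]
    gcongr
  · rw [← Order.lt_add_one_iff]
    refine lt_of_mul_lt_mul_left (lt_of_le_of_lt ?_ h₂) hm'.le
    rw [h]
    exact le_add_nonneg_right _ _

theorem quo_mul_self {m : M} (hm : m ≠ 0) (x : M) : quo (m * x) m = x :=
  quo_eq (add_zero _).symm (pos_iff_ne_zero.2 hm)

theorem fn_dvd {m : M} (hm : m ≠ 0) (x : M) [Decidable (m ∣ x)] :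
    fn .dvd ![m, x] = if m ∣ x then (1 : M) else 0 := by
  have : fn .dvd ![m, x] = fn .leq ![x, m * quo x m] := by simp [PVSym.dvd, fn_div]
  rw [this, fn_leq]
  congr 1
  refine propext ⟨fun h => ⟨quo x m, le_antisymm h (quo_spec hm x).1⟩, ?_⟩
  rintro ⟨y, rfl⟩
  rw [quo_mul_self hm]

theorem dvd_iff_le {m : M} (hm : m ≠ 0) (x : M) : m ∣ x ↔ x ≤ m * quo x m := by
  refine ⟨?_, fun h => ⟨quo x m, le_antisymm h (quo_spec hm x).1⟩⟩
  rintro ⟨y, rfl⟩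
  rw [quo_mul_self hm]

/-! ### Powers -/

/-- The value of `PVSym.pow`. -/
def pw (y p : M) : M := fn .pow ![y, p]

instance (f g : M → M) [DefFun f] [DefFun g] : DefFun fun x => pw (f x) (g x) :=
  DefFun.app₂ _ _ _

theorem fn_pow (y p : M) : fn .pow ![y, p] = pw y p := rfl

@[simp] theorem pw_zero (p : M) : pw 0 p = 1 := by
  rw [pw, PVSym.pow, fn_limRec_zero']; simp

theorem pw_le (y p : M) : pw y p ≤ sm p y := by
  by_cases h : y = 0
  · rw [h, pw_zero]; exact one_le_sm _ _
  · exact (fn_limRec_le h _).trans (by simp)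

theorem pw_of_ne {y : M} (h : y ≠ 0) (p : M) : pw y p = pw (hf y) p * p := by
  refine fn_limRec_eq h ![p] (r := pw (hf y) p) rfl (by simp) ?_
  simp only [fn_comp₂, fn_proj, fn_smash]
  change _ ≤ sm p y
  -- The bound grows fast enough: `p # y = (p # ⌊y/2⌋) · (1 # p)`, and `p < 1 # p`.
  rw [sm_comm, sm_of_ne p h, sm_comm]
  exact mul_le_mul' (pw_le _ _) (lt_sm_one p).le

theorem pw_ne_zero {p : M} (hp : p ≠ 0) (y : M) : pw y p ≠ 0 := by
  refine pind_open (fun y => pw y p ≠ 0) (by simp) (fun y hy ih => ?_) y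
  rw [pw_of_ne hy]
  exact mul_ne_zero ih hp

theorem sm_one_le_pw {p : M} (hp : 1 < p) (y : M) : sm 1 y ≤ pw y p := by
  refine pind_open (fun y => sm 1 y ≤ pw y p) (by simp [sm_comm 1 (0 : M)]) (fun y hy ih => ?_) y
  rw [← Order.add_one_le_iff, one_add_one_eq_two] at hp
  rw [pw_of_ne hy, sm_one_of_ne hy, mul_comm]
  exact mul_le_mul' ih hp

/-! ### The bit-length factorial -/

/-- The value of `PVSym.fact`. -/
def fct (x : M) : M := fn .fact ![x]

instance : DefFun (fct (M := M)) := DefFun.app₁ _ (fun x => x)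

@[simp] theorem fct_zero : fct (0 : M) = 1 := by
  rw [fct, PVSym.fact, fn_limRec_zero']; simp

theorem fct_le (x : M) : fct x ≤ sm x x := by
  by_cases h : x = 0
  · simp [h]
  · exact (fn_limRec_le h _).trans (by simp)

theorem fct_of_ne {x : M} (h : x ≠ 0) : fct x = fct (hf x) * ln x := by
  refine fn_limRec_eq h ![] (r := fct (hf x)) rfl (by simp) ?_
  simp only [fn_comp₂, fn_proj, fn_smash]
  change _ ≤ sm x x
  -- With `h = ⌊x/2⌋`, the bound `x # x` is `(h # h) · (1 # h) · (1 # x)`. The first factor bounds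
  -- the previous value, the second is at least `1`, and the third exceeds `|x|`.
  rw [sm_of_ne x h, sm_comm (hf x), sm_of_ne _ h]
  refine mul_le_mul' ((fct_le _).trans (le_mul_of_one_le_right (nonneg _) (one_le_sm _ _))) ?_
  exact (ln_le_self x).trans (lt_sm_one x).le

theorem fct_ne_zero (x : M) : fct x ≠ 0 := by
  refine pind_open (fun x => fct x ≠ 0) (by simp) (fun x hx ih => ?_) x
  rw [fct_of_ne hx]
  exact mul_ne_zero ih (fun h => hx (ln_eq_zero.1 h))

/-! ### The sum of quotients -/

/-- The value of `PVSym.sumDiv`. -/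
def quoSum (y m p : M) : M := fn .sumDiv ![y, m, p]

instance (f g h : M → M) [DefFun f] [DefFun g] [DefFun h] :
    DefFun fun x => quoSum (f x) (g x) (h x) := DefFun.app₃ _ _ _ _

@[simp] theorem quoSum_zero (m p : M) : quoSum 0 m p = 0 := by
  rw [quoSum, PVSym.sumDiv, fn_limRec_zero']; simp

theorem quoSum_le (y m p : M) : quoSum y m p ≤ m * ln y := by
  by_cases h : y = 0
  · simp [h]
  · exact (fn_limRec_le h _).trans (by simp)

theorem quoSum_of_ne {y : M} (h : y ≠ 0) (m p : M) :
    quoSum y m p = quoSum (hf y) m p + quo m (pw y p) := by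
  refine fn_limRec_eq h ![m, p] (r := quoSum (hf y) m p) rfl (by simp [fn_pow, fn_div]) ?_
  simp only [fn_comp₂, fn_comp₁, fn_proj, fn_len, fn_mul]
  change _ ≤ m * ln y
  rw [ln_of_ne h, mul_add_one]
  exact add_le_add (quoSum_le _ _ _) (quo_le _ _)

/-! ### The valuation -/

/-- The value of `PVSym.strip`. -/
def strip (y x p : M) : M := fn .strip ![y, x, p]

/-- The value of `PVSym.stripCount`. -/
def cnt (y x p : M) : M := fn .stripCount ![y, x, p]

/-- The value of `PVSym.nu`. -/
def nu (p x : M) : M := fn .nu ![p, x]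

instance (f g h : M → M) [DefFun f] [DefFun g] [DefFun h] :
    DefFun fun x => strip (f x) (g x) (h x) := DefFun.app₃ _ _ _ _

instance (f g h : M → M) [DefFun f] [DefFun g] [DefFun h] :
    DefFun fun x => cnt (f x) (g x) (h x) := DefFun.app₃ _ _ _ _

instance (f g : M → M) [DefFun f] [DefFun g] : DefFun fun x => nu (f x) (g x) :=
  DefFun.app₂ _ _ _

theorem nu_eq (p x : M) : nu p x = cnt x x p := by
  rw [nu, PVSym.nu]; simp [cnt]

@[simp] theorem strip_zero (x p : M) : strip 0 x p = x := by
  rw [strip, PVSym.strip, fn_limRec_zero']; simp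

theorem strip_le (y x p : M) : strip y x p ≤ x := by
  by_cases h : y = 0
  · simp [h]
  · exact (fn_limRec_le h _).trans (by simp)

@[simp] theorem cnt_zero (x p : M) : cnt 0 x p = 0 := by
  rw [cnt, PVSym.stripCount, fn_limRec_zero']; simp

theorem cnt_le (y x p : M) : cnt y x p ≤ ln y := by
  by_cases h : y = 0
  · simp [h]
  · exact (fn_limRec_le h _).trans (by simp)

open Classical in
theorem strip_of_ne {y p : M} (h : y ≠ 0) (hp : p ≠ 0) (x : M) :
    strip y x p =
      if p ∣ strip (hf y) x p then quo (strip (hf y) x p) p else strip (hf y) x p := by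
  refine fn_limRec_eq h ![x, p] (r := strip (hf y) x p) rfl ?_ ?_
  · simp only [fn_comp₃, fn_comp₂, fn_proj]
    change fn .cond ![fn .dvd ![p, _], quo _ p, _] = _
    rw [fn_cond, fn_dvd hp]
    split_ifs <;> simp_all
  · simp only [fn_proj]
    change _ ≤ x
    split_ifs
    exacts [(quo_le _ _).trans (strip_le _ _ _), strip_le _ _ _]

open Classical in
theorem cnt_of_ne {y p : M} (h : y ≠ 0) (hp : p ≠ 0) (x : M) :
    cnt y x p = cnt (hf y) x p + if p ∣ strip (hf y) x p then 1 else 0 := by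
  refine fn_limRec_eq h ![x, p] (r := cnt (hf y) x p) rfl ?_ ?_
  · simp only [fn_comp₃, fn_comp₂, fn_comp₁, fn_proj]
    change _ + fn .dvd ![p, strip (hf y) x p] = _
    rw [fn_dvd hp]; rfl
  · simp only [fn_comp₁, fn_proj, fn_len]
    change _ ≤ ln y
    rw [ln_of_ne h]
    refine add_le_add (cnt_le _ _ _) ?_
    split_ifs
    exacts [le_rfl, nonneg _]

end LegendreSymbols

/-! ### Divisibility, valuations and Legendre's formula in a model -/

section Legendre

variable {M : PV₁.ModelType.{0, 0, 0}}

/-- Divisibility is existential by definition, but the division symbol makes it open, hence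
admissible in polynomial induction. The divisor `0` is treated separately because the quotient by it
carries no information. -/
instance (f g : M → M) [DefFun f] [DefFun g] : DefPred fun x => f x ∣ g x := by
  have : (fun x => f x ∣ g x) =
      fun x => (f x = 0 → g x = 0) ∧ (f x ≠ 0 → g x ≤ f x * quo (g x) (f x)) := by
    funext x
    by_cases h : f x = 0
    · simp [h]
    · simp [h, dvd_iff_le]
  rw [this]
  infer_instance

theorem exists_quo_rem {m : M} (hm : m ≠ 0) (x : M) : ∃ q r, x = m * q + r ∧ r < m := by
  obtain ⟨h₁, h₂⟩ := quo_spec hm x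
  obtain ⟨r, hr⟩ := exists_add_of_le h₁
  refine ⟨quo x m, r, hr, ?_⟩
  rw [mul_add_one] at h₂
  exact lt_of_add_lt_add_left (hr.symm.trans_lt h₂)

theorem le_of_dvd_of_ne {d x : M} (hx : x ≠ 0) (h : d ∣ x) : d ≤ x := by
  obtain ⟨c, rfl⟩ := h
  exact le_mul_of_one_le_right (nonneg d) (one_le_iff.2 (right_ne_zero_of_mul hx))

theorem dvd_of_dvd_add {d a b : M} (h : d ∣ a) (h' : d ∣ a + b) : d ∣ b := by
  obtain ⟨u, rfl⟩ := h
  obtain ⟨v, hv⟩ := h'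
  rcases le_total u v with huv | huv
  · obtain ⟨w, rfl⟩ := exists_add_of_le huv
    rw [mul_add] at hv
    exact ⟨w, add_left_cancel hv⟩
  · have : d * u + b ≤ d * u + 0 := by
      rw [hv, add_zero]; exact mul_le_mul_right huv d
    rw [nonpos_iff_eq_zero.1 (le_of_add_le_add_left this)]
    exact dvd_zero d

open Classical in
-- Adding one either raises the remainder, which stays below `m`, or completes a further multiple of
-- `m`.
theorem quo_add_one {m : M} (hm : m ≠ 0) (x : M) :
    quo (x + 1) m = quo x m + if m ∣ x + 1 then 1 else 0 := by
  obtain ⟨q, r, rfl, hr⟩ := exists_quo_rem hm x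
  rw [quo_eq rfl hr]
  rcases (Order.add_one_le_iff.2 hr).lt_or_eq with h | h
  · rw [quo_eq (add_assoc _ _ _) h, if_neg, add_zero]
    intro hd
    rw [add_assoc] at hd
    have := le_of_dvd_of_ne (by simp) (dvd_of_dvd_add (dvd_mul_right m q) hd)
    exact not_le_of_gt h this
  · rw [add_assoc, h, ← mul_add_one, quo_mul_self hm, if_pos (dvd_mul_right _ _)]

/-! ### Functions of the length -/

/-- `ones y` is the number with `|y|` binary digits that are all ones. -/
def PVSym.ones : PVSym 1 :=
  limRec zero (comp succ ![comp add ![proj 1, proj 1] ]) (comp smash ![const1 1, proj 0])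

/-- The value of `PVSym.ones`. -/
def ones (y : M) : M := fn .ones ![y]

instance (f : M → M) [DefFun f] : DefFun fun x => ones (f x) := DefFun.app₁ _ _

instance : DefFun (ones (M := M)) := DefFun.app₁ _ _

@[simp] theorem ones_zero : ones (0 : M) = 0 := fn_limRec_zero' _ _ _ _

/-- Both parts are proved together: the recursion equation needs the bound `1 # y`, which is doubled
in each step and is respected because `ones + 1` equals it one step earlier. -/
theorem ones_spec (y : M) :
    ones y + 1 = sm 1 y ∧ (y ≠ 0 → ones y = ones (hf y) + ones (hf y) + 1) := by
  refine pind_open (fun y => ones y + 1 = sm 1 y ∧ (y ≠ 0 → ones y = ones (hf y) + ones (hf y) + 1))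
    (by simp [sm_comm 1 (0 : M)]) (fun y hy ih => ?_) y
  have e : ones (hf y) + ones (hf y) + 1 + 1 = sm 1 y := by
    rw [sm_one_of_ne hy, ← ih.1]; ring
  have : ones y = ones (hf y) + ones (hf y) + 1 := by
    refine fn_limRec_eq hy ![] (r := ones (hf y)) rfl (by simp) ?_
    simp only [fn_comp₂, fn_const1, fn_proj, fn_smash]
    change _ ≤ sm 1 y
    rw [← e]
    exact le_add_nonneg_right _ _
  exact ⟨this ▸ e, fun _ => this⟩

theorem ones_congr {y z : M} (h : ln y = ln z) : ones y = ones z := by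
  have : ones y + 1 = ones z + 1 := by
    rw [(ones_spec y).1, (ones_spec z).1, sm_comm, sm_congr 1 h, sm_comm]
  exact add_right_cancel this

/-- The two recursions use `y` only to count rounds, and `ones` commutes with halving. Passing to
this canonical number of the same length avoids a simultaneous induction on two numbers in
`cnt_congr`. -/
theorem cnt_ones {p : M} (hp : p ≠ 0) (x y : M) :
    cnt (ones y) x p = cnt y x p ∧ strip (ones y) x p = strip y x p := by
  refine pind_open (fun y => cnt (ones y) x p = cnt y x p ∧ strip (ones y) x p = strip y x p)
    (by simp) (fun y hy ih => ?_) y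
  have h := (ones_spec y).2 hy
  have h0 : ones y ≠ 0 := by rw [h]; simp
  have hh : hf (ones y) = ones (hf y) := by rw [h, half_add_half_add_one]
  rw [cnt_of_ne h0 hp, cnt_of_ne hy hp, strip_of_ne h0 hp, strip_of_ne hy hp, hh, ih.1, ih.2]
  exact ⟨rfl, rfl⟩

/-- The number of divisions only depends on the length of the first argument. -/
theorem cnt_congr {p : M} (hp : p ≠ 0) (x : M) {y z : M} (h : ln y = ln z) :
    cnt y x p = cnt z x p := by
  rw [← (cnt_ones hp x y).1, ← (cnt_ones hp x z).1, ones_congr h]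

/-! ### Properties of the valuation -/

section Valuation

variable {p : M}

/-- Invariant of repeated division: either all `|y|` divisions have succeeded, and their product is
the full power, or one has failed, and from then on the value is fixed and not divisible by `p`. -/
theorem strip_spec (hp : p ≠ 0) (x y : M) : (cnt y x p = ln y → pw y p * strip y x p = x) ∧
    (cnt y x p ≠ ln y → ¬ p ∣ strip y x p) := by
  refine pind_open (fun y => (cnt y x p = ln y → pw y p * strip y x p = x) ∧
    (cnt y x p ≠ ln y → ¬ p ∣ strip y x p)) (by simp) (fun y hy ih => ?_) y
  rw [cnt_of_ne hy hp, strip_of_ne hy hp, ln_of_ne hy, pw_of_ne hy]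
  split_ifs with h
  · obtain ⟨c, hc⟩ := h
    have h1 : cnt (hf y) x p = ln (hf y) := by
      by_contra h1
      exact ih.2 h1 ⟨c, hc⟩
    refine ⟨fun _ => ?_, fun h2 => absurd (by rw [h1]) h2⟩
    rw [hc, quo_mul_self hp, mul_assoc, ← hc, ih.1 h1]
  · refine ⟨fun h2 => ?_, fun _ => h⟩
    have := cnt_le (hf y) x p
    rw [add_zero] at h2
    rw [h2, Order.add_one_le_iff] at this
    exact absurd this (lt_irrefl _)

theorem pw_dvd_iff (hp : p ≠ 0) (x y : M) : pw y p ∣ x ↔ cnt y x p = ln y := by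
  refine ⟨pind_open (fun y => pw y p ∣ x → cnt y x p = ln y) (by simp) (fun y hy ih h => ?_) y,
    fun h => ⟨_, ((strip_spec hp x y).1 h).symm⟩⟩
  rw [pw_of_ne hy] at h
  have h1 := ih (dvd_of_mul_right_dvd h)
  have h2 := (strip_spec hp x (hf y)).1 h1
  rw [cnt_of_ne hy hp, ln_of_ne hy, h1, if_pos]
  rw [← h2] at h
  exact (mul_dvd_mul_iff_left (pw_ne_zero hp _)).1 h

/-- If all divisions succeeded, `p^|y|` would divide `x`; but `x < 2^|y| ≤ p^|y|`. -/
theorem cnt_ne_ln (hp : 1 < p) {x y : M} (hx : x ≠ 0) (h : ln x ≤ ln y) : cnt y x p ≠ ln y := by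
  rw [ne_eq, ← pw_dvd_iff (zero_lt_one.trans hp).ne']
  intro hd
  have h1 := le_of_dvd_of_ne hx hd
  have h2 : x < sm 1 y := by
    rcases h.lt_or_eq with h | h
    · exact (lt_of_not_ge fun h' => not_le_of_gt h (ln_mono h')).trans (lt_sm_one y)
    · rw [sm_comm, ← sm_congr 1 h, sm_comm]
      exact lt_sm_one x
  exact not_le_of_gt (h2.trans_le (sm_one_le_pw hp y)) h1

/-- The number of divisions is constant from the length of `x` on. -/
theorem cnt_eq_of_le (hp : 1 < p) {x v : M} (hx : x ≠ 0) (hv : ln x ≤ ln v) {u : M}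
    (hu : ln v ≤ ln u) : cnt u x p = cnt v x p := by
  have hp0 : p ≠ 0 := (zero_lt_one.trans hp).ne'
  refine pind_open (fun u => ln v ≤ ln u → cnt u x p = cnt v x p) (fun h => ?_)
    (fun u hu ih h => ?_) u hu
  · exact cnt_congr hp0 x (le_antisymm (by simp) h)
  · rcases h.lt_or_eq with h | h
    · rw [ln_of_ne hu, Order.lt_add_one_iff] at h
      rw [cnt_of_ne hu hp0, if_neg, add_zero, ih h]
      exact (strip_spec hp0 x _).2 (cnt_ne_ln hp hx (hv.trans h))
    · exact cnt_congr hp0 x h.symm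

/-- The first round on `p x` removes `p`; afterwards the run coincides with the run on `x`, one
round behind. -/
theorem cnt_mul_left (hp : p ≠ 0) (x : M) {y : M} (hy : y ≠ 0) :
    cnt y (p * x) p = cnt (hf y) x p + 1 ∧ strip y (p * x) p = strip (hf y) x p := by
  refine pind_open (fun y => y ≠ 0 → cnt y (p * x) p = cnt (hf y) x p + 1 ∧
    strip y (p * x) p = strip (hf y) x p) (fun h => absurd rfl h) (fun y hy ih _ => ?_) y hy
  rw [cnt_of_ne hy hp, strip_of_ne hy hp]
  by_cases h : hf y = 0
  · simp [h, quo_mul_self hp]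
  · rw [(ih h).1, (ih h).2, cnt_of_ne h hp, strip_of_ne h hp, add_right_comm]
    exact ⟨rfl, rfl⟩

theorem nu_mul_left (hp : 1 < p) {x : M} (hx : x ≠ 0) : nu p (p * x) = nu p x + 1 := by
  have hp0 : p ≠ 0 := (zero_lt_one.trans hp).ne'
  rw [nu_eq, nu_eq, (cnt_mul_left hp0 x (mul_ne_zero hp0 hx)).1,
    cnt_eq_of_le hp hx le_rfl (ln_mono ?_)]
  -- It remains to see `x ≤ ⌊p x / 2⌋`, which holds since `2 x ≤ p x`; then the remaining rounds
  -- suffice for the full count on `x`.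
  by_contra h
  rw [not_le, ← Order.add_one_le_iff] at h
  have h1 := le_half_add_half (p * x)
  have h2 : x + x ≤ p * x := by
    rw [← two_mul]
    rw [← Order.add_one_le_iff, one_add_one_eq_two] at hp
    exact mul_le_mul_left hp x
  have := zero_lt_one (α := M)
  grind

theorem cnt_of_not_dvd (hp : p ≠ 0) {x : M} (h : ¬ p ∣ x) (y : M) :
    cnt y x p = 0 ∧ strip y x p = x := by
  refine pind_open (fun y => cnt y x p = 0 ∧ strip y x p = x) (by simp) (fun y hy ih => ?_) y
  rw [cnt_of_ne hy hp, strip_of_ne hy hp, ih.1, ih.2]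
  simp [h]

theorem nu_of_not_dvd (hp : p ≠ 0) {x : M} (h : ¬ p ∣ x) : nu p x = 0 := by
  rw [nu_eq, (cnt_of_not_dvd hp h x).1]

theorem nu_of_dvd (hp : 1 < p) {x : M} (hx : x ≠ 0) (h : p ∣ x) :
    nu p x = nu p (quo x p) + 1 := by
  obtain ⟨y, rfl⟩ := h
  rw [quo_mul_self (zero_lt_one.trans hp).ne', nu_mul_left hp (right_ne_zero_of_mul hx)]

theorem strip_ne_zero (hp : p ≠ 0) {x : M} (hx : x ≠ 0) (y : M) : strip y x p ≠ 0 := by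
  refine pind_open (fun y => strip y x p ≠ 0) (by simpa) (fun y hy ih => ?_) y
  rw [strip_of_ne hy hp]
  split_ifs with h
  · obtain ⟨c, hc⟩ := h
    rw [hc] at ih
    rw [hc, quo_mul_self hp]
    exact right_ne_zero_of_mul ih
  · exact ih

theorem not_dvd_strip_self (hp : 1 < p) {x : M} (hx : x ≠ 0) : ¬ p ∣ strip x x p :=
  (strip_spec (zero_lt_one.trans hp).ne' x x).2 (cnt_ne_ln hp hx le_rfl)

/-- Each successful division takes one factor `p` out of the product, which costs one by
`nu_mul_left`. This reduces additivity of the valuation to factors prime to `p`. -/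
theorem nu_mul_strip (hp : 1 < p) {b x : M} (hb : b ≠ 0) (hx : x ≠ 0) (y : M) :
    nu p (b * x) = nu p (b * strip y x p) + cnt y x p := by
  have hp0 : p ≠ 0 := (zero_lt_one.trans hp).ne'
  refine pind_open (fun y => nu p (b * x) = nu p (b * strip y x p) + cnt y x p) (by simp)
    (fun y hy ih => ?_) y
  have h0 := strip_ne_zero hp0 hx (hf y)
  rw [strip_of_ne hy hp0, cnt_of_ne hy hp0, ih]
  split_ifs with h
  · obtain ⟨c, hc⟩ := h
    rw [hc] at h0
    rw [hc, quo_mul_self hp0, mul_left_comm,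
      nu_mul_left hp (mul_ne_zero hb (right_ne_zero_of_mul h0))]
    ring
  · rw [add_zero]

end Valuation

/-! ### Euclid's lemma for a small factor -/

/-- `leastMul (z, a, p)` is the least `j` with `1 ≤ j ≤ |z|` such that `p` divides `a j`, and `0` if
there is none. -/
def PVSym.leastMul : PVSym 3 :=
  limRec (const0 2)
    (comp cond ![proj 1, proj 1,
      comp cond ![comp dvd ![proj 3, comp mul ![proj 2, comp len ![proj 0] ] ],
        comp len ![proj 0], const0 4] ])
    (comp len ![proj 0])

/-- The value of `PVSym.leastMul`. -/
def leastMul (z a p : M) : M := fn .leastMul ![z, a, p]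

instance (f g h : M → M) [DefFun f] [DefFun g] [DefFun h] :
    DefFun fun x => leastMul (f x) (g x) (h x) := DefFun.app₃ _ _ _ _

@[simp] theorem leastMul_zero (a p : M) : leastMul 0 a p = 0 := by
  rw [leastMul, PVSym.leastMul, fn_limRec_zero']; simp

theorem leastMul_le (z a p : M) : leastMul z a p ≤ ln z := by
  by_cases h : z = 0
  · simp [h]
  · exact (fn_limRec_le h _).trans (by simp)

open Classical in
theorem leastMul_of_ne {z p : M} (h : z ≠ 0) (hp : p ≠ 0) (a : M) :
    leastMul z a p = if leastMul (hf z) a p = 0 then if p ∣ a * ln z then ln z else 0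
      else leastMul (hf z) a p := by
  refine fn_limRec_eq h ![a, p] (r := leastMul (hf z) a p) rfl ?_ ?_
  · simp only [fn_comp₃, fn_comp₂, fn_comp₁, fn_proj, fn_const0]
    change fn .cond ![leastMul (hf z) a p, leastMul (hf z) a p,
      fn .cond ![fn .dvd ![p, a * ln z], ln z, 0] ] = _
    rw [fn_cond, fn_cond, fn_dvd hp]
    split_ifs <;> simp_all
  · simp only [fn_comp₁, fn_proj, fn_len]
    change _ ≤ ln z
    split_ifs
    exacts [le_rfl, nonneg _, (leastMul_le _ _ _).trans (ln_mono (half_le z))]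

theorem dvd_mul_leastMul {p : M} (hp : p ≠ 0) (a z : M) : p ∣ a * leastMul z a p := by
  refine pind_open (fun z => p ∣ a * leastMul z a p) (by simp) (fun z hz ih => ?_) z
  rw [leastMul_of_ne hz hp]
  split_ifs with h h'
  exacts [h', by simp, ih]

theorem leastMul_le_of_dvd {p : M} (hp : p ≠ 0) (a : M) {j z : M} (hj : j ≠ 0) (hz : j ≤ ln z)
    (h : p ∣ a * j) : leastMul z a p ≠ 0 ∧ leastMul z a p ≤ j := by
  refine pind_open (fun z => j ≤ ln z → leastMul z a p ≠ 0 ∧ leastMul z a p ≤ j)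
    (fun h0 => absurd (nonpos_iff_eq_zero.1 (by simpa using h0)) hj) (fun z hz ih hjz => ?_) z hz
  rw [leastMul_of_ne hz hp]
  rcases hjz.lt_or_eq with h1 | h1
  · rw [ln_of_ne hz, Order.lt_add_one_iff] at h1
    rw [if_neg (ih h1).1]
    exact ih h1
  · rw [← h1, if_pos h]
    split_ifs with h2
    · exact ⟨hj, le_rfl⟩
    · refine ⟨h2, (leastMul_le _ _ _).trans ?_⟩
      rw [h1]
      exact ln_mono (half_le z)

/-- Let `d` be the least `j ≥ 1` with `p ∣ a j`; it exists below `|z|` because `k` is such a `j`,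
unless `k = 0`. Then `d` divides every such `j`, in particular `p` and `k`. Either `d = 1` and `p ∣
a`, or `d = p` and `p ∣ k`. -/
theorem euclid_lemma {p : M} (hp : 1 < p) (hprime : ∀ y, y ∣ p → y = 1 ∨ y = p) {a k z : M}
    (hk : k ≤ ln z) (h : p ∣ a * k) : p ∣ a ∨ p ∣ k := by
  have hp0 : p ≠ 0 := (zero_lt_one.trans hp).ne'
  by_cases hk0 : k = 0
  · exact Or.inr (hk0 ▸ dvd_zero p)
  have hd0 := (leastMul_le_of_dvd hp0 a hk0 hk h).1
  -- Here `j` need not be at most `|z|`: minimality is applied only to the remainder, which is below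
  -- `d ≤ |z|`.
  have key : ∀ j, p ∣ a * j → leastMul z a p ∣ j := by
    intro j hj
    obtain ⟨q, r, rfl, hr⟩ := exists_quo_rem hd0 j
    rw [mul_add, ← mul_assoc] at hj
    have h1 := dvd_of_dvd_add ((dvd_mul_leastMul hp0 a z).mul_right q) hj
    by_cases hr0 : r = 0
    · rw [hr0, add_zero]; exact dvd_mul_right _ _
    · exact absurd (leastMul_le_of_dvd hp0 a hr0 (hr.le.trans (leastMul_le _ _ _)) h1).2
        (not_le_of_gt hr)
  rcases hprime _ (key p (dvd_mul_left p a)) with h1 | h1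
  · left
    simpa [h1] using dvd_mul_leastMul hp0 a z
  · right
    simpa [h1] using key k h

/-! ### Legendre's formula -/

/-- All factors `p` are stripped from `k` and from `a`. The two cofactors are prime to `p`, and so
is their product by Euclid's lemma, which applies because the cofactor of `k` is still at most
`|z|`. -/
theorem nu_mul {p : M} (hp : 1 < p) (hprime : ∀ y, y ∣ p → y = 1 ∨ y = p) {a k z : M}
    (hk : k ≤ ln z) (ha : a ≠ 0) (hk0 : k ≠ 0) : nu p (a * k) = nu p a + nu p k := by
  have hp0 : p ≠ 0 := (zero_lt_one.trans hp).ne'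
  have hs := strip_ne_zero hp0 hk0 k
  rw [nu_mul_strip hp ha hk0 k, mul_comm, nu_mul_strip hp hs ha a, mul_comm, nu_of_not_dvd hp0,
    zero_add, nu_eq, nu_eq]
  intro h
  rcases euclid_lemma hp hprime ((strip_le _ _ _).trans hk) h with h | h
  exacts [not_dvd_strip_self hp ha h, not_dvd_strip_self hp hk0 h]

/-- The `i`-th summand grows by one exactly if `p^i ∣ k + 1`, that is, if the `i`-th division of `k
+ 1` by `p` succeeds. -/
theorem quoSum_add_one {p : M} (hp : p ≠ 0) (y k : M) :
    quoSum y (k + 1) p = quoSum y k p + cnt y (k + 1) p := by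
  refine pind_open (fun y => quoSum y (k + 1) p = quoSum y k p + cnt y (k + 1) p) (by simp)
    (fun y hy ih => ?_) y
  have h : pw y p ∣ k + 1 ↔ p ∣ strip (hf y) (k + 1) p := by
    rw [pw_dvd_iff hp, cnt_of_ne hy hp, ln_of_ne hy]
    split_ifs with h
    · refine iff_of_true ?_ h
      by_contra h'
      exact (strip_spec hp (k + 1) (hf y)).2 (fun h1 => h' (by rw [h1])) h
    · refine iff_of_false (fun h1 => ?_) h
      have := cnt_le (hf y) (k + 1) p
      rw [add_zero] at h1
      rw [h1, Order.add_one_le_iff] at this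
      exact lt_irrefl _ this
  rw [quoSum_of_ne hy, quoSum_of_ne hy, cnt_of_ne hy hp, quo_add_one (pw_ne_zero hp y), ih]
  by_cases h' : p ∣ strip (hf y) (k + 1) p
  · rw [if_pos (h.2 h'), if_pos h']; ring
  · rw [if_neg (fun h1 => h' (h.1 h1)), if_neg h']; ring

theorem legendre {p : M} (hp : 1 < p) (hprime : ∀ y, y ∣ p → y = 1 ∨ y = p) (x : M) :
    nu p (fct x) = quoSum (ln x) (ln x) p := by
  have hp0 : p ≠ 0 := (zero_lt_one.trans hp).ne'
  -- The range of summation stays at `||x||` while `w` varies, so that only the numerators change in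
  -- the step.
  refine pind_open (fun w => w ≤ x → nu p (fct w) = quoSum (ln x) (ln w) p) (fun _ => ?_)
    (fun w hw ih hwx => ?_) x le_rfl
  · rw [fct_zero, ln_zero, nu_of_not_dvd hp0]
    · refine (pind_open (fun y => quoSum y 0 p = 0) (by simp) (fun y hy ih => ?_) _).symm
      rw [quoSum_of_ne hy, ih, quo_zero, add_zero]
    · exact fun h => not_le_of_gt hp (le_of_dvd_of_ne one_ne_zero h)
  · have hl : ln w ≠ 0 := fun h => hw (ln_eq_zero.1 h)
    -- Since `|w| ≤ |x|`, the `||x||` rounds are at least the `||w||` rounds that already give the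
    -- full valuation of `|w|`.
    have hn : nu p (ln w) = cnt (ln x) (ln w) p := by
      rw [nu_eq, cnt_eq_of_le hp hl le_rfl (ln_mono (ln_mono hwx))]
    rw [fct_of_ne hw, nu_mul hp hprime le_rfl (fct_ne_zero _) hl, ih ((half_le w).trans hwx), hn,
      ln_of_ne hw, quoSum_add_one hp0]

end Legendre

/-! ### Meaning of the abbreviating terms and formulas in a model -/

section RealizeLegendre

variable {M : PV₁.ModelType.{0, 0, 0}} {n : ℕ} (v : Empty → M) (xs : Fin n → M) (t u w : Tm n)

@[simp] theorem realize_divT : (divT t u).realize (Sum.elim v xs) =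
    quo (t.realize (Sum.elim v xs)) (u.realize (Sum.elim v xs)) := realize_app₂ _ _ _ _

@[simp] theorem realize_powT : (powT t u).realize (Sum.elim v xs) =
    pw (u.realize (Sum.elim v xs)) (t.realize (Sum.elim v xs)) := realize_app₂ _ _ _ _

@[simp] theorem realize_nuT : (nuT t u).realize (Sum.elim v xs) =
    nu (t.realize (Sum.elim v xs)) (u.realize (Sum.elim v xs)) := realize_app₂ _ _ _ _

@[simp] theorem realize_factT : (factT t).realize (Sum.elim v xs) =
    fct (t.realize (Sum.elim v xs)) := realize_app₁ _ _ _

@[simp] theorem realize_sumT : (sumT t u w).realize (Sum.elim v xs) =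
    quoSum (t.realize (Sum.elim v xs)) (u.realize (Sum.elim v xs)) (w.realize (Sum.elim v xs)) :=
  realize_app₃ _ _ _ _ _

@[simp] theorem realize_up (a : M) : (up t).realize (Sum.elim v (Fin.snoc xs a : Fin (n + 1) → M)) =
    t.realize (Sum.elim v xs) := by
  rw [up, Term.realize_relabel]
  congr 1
  funext i
  rcases i with i | i <;> simp

theorem realize_last (a : M) :
    (&(Fin.last n) : Tm (n + 1)).realize (Sum.elim v (Fin.snoc xs a : Fin (n + 1) → M)) = a := by
  simp

@[simp] theorem realize_lt : (lt t u).Realize v xs ↔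
    t.realize (Sum.elim v xs) < u.realize (Sum.elim v xs) := by
  rw [lt, BoundedFormula.realize_inf, realize_le, BoundedFormula.realize_not,
    BoundedFormula.realize_bdEqual, lt_iff_le_and_ne]

/-- The bound on the witness in the formula is automatic for a nonzero divisor, since `z ≤ t z`. -/
theorem realize_dvdF (ht : t.realize (Sum.elim v xs) ≠ 0) : (dvdF t u).Realize v xs ↔
    t.realize (Sum.elim v xs) ∣ u.realize (Sum.elim v xs) := by
  simp only [dvdF, BoundedFormula.realize_ex, BoundedFormula.realize_inf, realize_le,
    BoundedFormula.realize_bdEqual, realize_mul, realize_up, realize_last]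
  refine ⟨fun ⟨z, _, hz⟩ => ⟨z, hz.symm⟩, fun ⟨z, hz⟩ => ⟨z, ?_, hz.symm⟩⟩
  rw [hz]
  exact le_mul_of_one_le_left (nonneg z) (one_le_iff.2 ht)

/-- The bounded quantifier covers all divisors, as a divisor of a nonzero number does not exceed it.
-/
theorem realize_primeF (h : (primeF t).Realize v xs) :
    1 < t.realize (Sum.elim v xs) ∧ ∀ y, y ∣ t.realize (Sum.elim v xs) →
      y = 1 ∨ y = t.realize (Sum.elim v xs) := by
  simp only [primeF, BoundedFormula.realize_inf, realize_lt, realize_one,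
    BoundedFormula.realize_all, BoundedFormula.realize_imp, realize_le, realize_up,
    realize_last, BoundedFormula.realize_sup, BoundedFormula.realize_bdEqual] at h
  refine ⟨h.1, fun y hy => ?_⟩
  have ht : t.realize (Sum.elim v xs) ≠ 0 := (zero_lt_one.trans h.1).ne'
  refine h.2 y (le_of_dvd_of_ne ht hy) ((realize_dvdF _ _ _ _ ?_).2 ?_)
  · rw [realize_last]; exact ne_zero_of_dvd_ne_zero ht hy
  · rwa [realize_last, realize_up]

end RealizeLegendre

end BoundedArith

open BoundedArith
/-- `PV₁` proves the equations that characterize the PV symbols for `⌊x / m⌋`, `p ^ |y|`, `ν_p(x)`,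
`Fact(x)` and `∑_{i = 1}^{|y|} ⌊m / p ^ i⌋`, and it proves the formula of Legendre. -/
theorem mainTheorem8 :
    -- with `x = &0`, `m = &1`: `m ≠ 0 → m · ⌊x / m⌋ ≤ x ∧ x < m · (⌊x / m⌋ + 1)`
    PV₁ ⊨ᵇ (∀' ∀' (ne &1 0 ⟹
      (le (&1 * divT &0 &1) &0 ⊓ lt &0 (&1 * (divT &0 &1 + 1)))) : PV.Sentence) ∧
    -- with `p = &0`, `y = &1`: `p ^ |0| = 1`, and `p ^ |y| = p ^ |⌊y / 2⌋| · p` for `y ≠ 0`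
    PV₁ ⊨ᵇ (∀' ∀' (powT &0 0 =' 1 ⊓
      (ne &1 0 ⟹ powT &0 &1 =' (powT &0 (half &1) * &0))) : PV.Sentence) ∧
    -- with `p = &0`, `x = &1`: `ν_p(0) = 0`, and for `p > 1` and `x ≠ 0`,
    -- `ν_p(x) = ν_p(⌊x / p⌋) + 1` if `p ∣ x`, and `ν_p(x) = 0` otherwise
    PV₁ ⊨ᵇ (∀' ∀' (nuT &0 0 =' 0 ⊓ ((lt 1 &0 ⊓ ne &1 0) ⟹
      ((dvdF &0 &1 ⟹ nuT &0 &1 =' (nuT &0 (divT &1 &0) + 1)) ⊓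
        (∼(dvdF &0 &1) ⟹ nuT &0 &1 =' 0)))) : PV.Sentence) ∧
    -- with `x = &0`: `Fact(0) = 1`, and `Fact(x) = Fact(⌊x / 2⌋) · |x|` for `x ≠ 0`
    PV₁ ⊨ᵇ (∀' (factT 0 =' 1 ⊓
      (ne &0 0 ⟹ factT &0 =' (factT (half &0) * len &0))) : PV.Sentence) ∧
    -- with `y = &0`, `m = &1`, `p = &2`: the sum is `0` for `y = 0`, and for `y ≠ 0` it is
    -- the sum for `⌊y / 2⌋` plus `⌊m / p ^ |y|⌋`
    PV₁ ⊨ᵇ (∀' ∀' ∀' (sumT 0 &1 &2 =' 0 ⊓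
      (ne &0 0 ⟹ sumT &0 &1 &2 =' (sumT (half &0) &1 &2 + divT &1 (powT &2 &0)))) :
        PV.Sentence) ∧
    -- with `x = &0`, `n = &1`, `p = &2`:
    -- `x = 1^(n) ∧ Prime(p) → ν_p(Fact(x)) = ∑_{i = 1}^{|n|} ⌊n / p ^ i⌋`
    PV₁ ⊨ᵇ (∀' ∀' ∀' ((unaryF &0 &1 ⊓ primeF &2) ⟹
      nuT &2 (factT &0) =' sumT &1 &1 &2) : PV.Sentence) := by
  -- The outermost quantifier binds `&0`, so the variables take their values in the order of the
  -- quantifiers.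
  have h0 {M : PV₁.ModelType.{0, 0, 0}} (v : Empty → M) (xs : Fin 0 → M) (a b c : M) :
      Term.realize (Sum.elim v (Fin.snoc (Fin.snoc (Fin.snoc xs a : Fin 1 → M) b : Fin 2 → M) c :
        Fin 3 → M)) (&0 : Tm 3) = a := rfl
  have h1 {M : PV₁.ModelType.{0, 0, 0}} (v : Empty → M) (xs : Fin 0 → M) (a b c : M) :
      Term.realize (Sum.elim v (Fin.snoc (Fin.snoc (Fin.snoc xs a : Fin 1 → M) b : Fin 2 → M) c :
        Fin 3 → M)) (&1 : Tm 3) = b := rfl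
  have h2 {M : PV₁.ModelType.{0, 0, 0}} (v : Empty → M) (xs : Fin 0 → M) (a b c : M) :
      Term.realize (Sum.elim v (Fin.snoc (Fin.snoc (Fin.snoc xs a : Fin 1 → M) b : Fin 2 → M) c :
        Fin 3 → M)) (&2 : Tm 3) = c := rfl
  have k0 {M : PV₁.ModelType.{0, 0, 0}} (v : Empty → M) (xs : Fin 0 → M) (a b : M) :
      Term.realize (Sum.elim v (Fin.snoc (Fin.snoc xs a : Fin 1 → M) b : Fin 2 → M))
        (&0 : Tm 2) = a := rfl
  have k1 {M : PV₁.ModelType.{0, 0, 0}} (v : Empty → M) (xs : Fin 0 → M) (a b : M) :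
      Term.realize (Sum.elim v (Fin.snoc (Fin.snoc xs a : Fin 1 → M) b : Fin 2 → M))
        (&1 : Tm 2) = b := rfl
  have l0 {M : PV₁.ModelType.{0, 0, 0}} (v : Empty → M) (xs : Fin 0 → M) (a : M) :
      Term.realize (Sum.elim v (Fin.snoc xs a : Fin 1 → M)) (&0 : Tm 1) = a := rfl
  refine ⟨?_, ?_, ?_, ?_, ?_, ?_⟩ <;> intro M v xs <;>
    simp only [BoundedFormula.realize_all, BoundedFormula.realize_imp, BoundedFormula.realize_inf,
      BoundedFormula.realize_not, BoundedFormula.realize_bdEqual, realize_le, realize_lt,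
      realize_ne, realize_mul, realize_add, realize_one, realize_zero, realize_half, realize_len,
      realize_divT, realize_powT, realize_nuT, realize_factT, realize_sumT, unaryF,
      h0, h1, h2, k0, k1, l0]
  · exact fun x m hm => quo_spec hm x
  · exact fun p y => ⟨pw_zero p, fun hy => pw_of_ne hy p⟩
  · refine fun p x => ⟨by rw [nu_eq, cnt_zero], fun ⟨hp, hx⟩ => ?_⟩
    have hp0 : p ≠ 0 := (zero_lt_one.trans hp).ne'
    rw [realize_dvdF, k0, k1]
    exacts [⟨nu_of_dvd hp hx, nu_of_not_dvd hp0⟩, by rwa [k0] ]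
  · exact fun x => ⟨fct_zero, fct_of_ne⟩
  · exact fun y m p => ⟨quoSum_zero m p, fun hy => quoSum_of_ne hy m p⟩
  -- The equation `|x| = n` replaces `n` by `|x|`, so the sum becomes the one in `legendre`.
  · rintro x n p ⟨⟨rfl, -⟩, hp⟩
    obtain ⟨hp, hprime⟩ := realize_primeF _ _ _ hp
    rw [h2] at hp hprime
    exact legendre hp hprime x
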